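/- All graphs are finite, simple and undirected. A graph is \emph{outerplanar} if it has a crossing-free embedding in the plane (vertices are distinct points, edges are simple arcs joining their ends, and arcs meet only in common end vertices) such that all vertices lie on the boundary of the outer (unbounded) face. A \emph{maximal outerplanar graph} is an outerplanar graph such that adding an edge between any two distinct non-adjacent vertices results in a graph that is not outerplanar. A set $S \subseteq V(G)$ is a \emph{total dominating set} of $G$ if every vertex of $G$ is adjacent to some vertex in $S$. A total dominating set $S$ is a \emph{secure total dominating set} if for every $u \in V(G) \setminus S$ there is a vertex $v \in S$ such that $uv \in E(G)$ and $(S \setminus \{v\}) \cup \{u\}$ is also a total dominating set of $G$. The \emph{secure total domination number} $\gamma_{st}(G)$ is the smallest cardinality of a secure total dominating set of $G$ (and $\infty$ if there is none). \textbf{Theorem.} For every maximal outerplanar graph $G$ on $n \geq 3$ vertices, $$\gamma_{st}(G) \leq \left\lfloor \frac{2n}{3} \right\rfloor .$$ In particular, $G$ has a secure total dominating set. -/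

import Mathlib

namespace SimpleGraph

/-- The Euclidean plane. -/
abbrev Plane : Type := EuclideanSpace ℝ (Fin 2)

/-- `A` is a simple arc in the plane with end points `x` and `y`: the range of a continuous
injective map of the unit interval that starts at `x` and ends at `y`. -/
def IsSimpleArc (A : Set Plane) (x y : Plane) : Prop :=
  ∃ γ : unitInterval → Plane, Continuous γ ∧ Function.Injective γ ∧
    γ 0 = x ∧ γ 1 = y ∧ Set.range γ = A

/-- A crossing-free drawing of `G` in the plane: the vertices are distinct points, each edge is a
simple arc joining the points of its two ends and passing through no other vertex, and two
distinct edges meet at most in the points of common ends. (The value of `arc` at a pair that is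
not an edge of `G` plays no role.) -/
structure PlaneEmbedding {V : Type*} (G : SimpleGraph V) where
  /-- the point that represents a vertex -/
  pos : V → Plane
  /-- the arc that represents an edge -/
  arc : Sym2 V → Set Plane
  pos_injective : Function.Injective pos
  isSimpleArc : ∀ u v : V, G.Adj u v → IsSimpleArc (arc s(u, v)) (pos u) (pos v)
  mem_of_pos_mem_arc : ∀ e ∈ G.edgeSet, ∀ w : V, pos w ∈ arc e → w ∈ e
  arc_inter_arc : ∀ e ∈ G.edgeSet, ∀ f ∈ G.edgeSet, e ≠ f →
    ∀ p ∈ arc e ∩ arc f, ∃ w : V, w ∈ e ∧ w ∈ f ∧ p = pos w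

/-- The set of all points of the drawing. -/
def PlaneEmbedding.carrier {V : Type*} {G : SimpleGraph V} (D : G.PlaneEmbedding) : Set Plane :=
  Set.range D.pos ∪ ⋃ e ∈ G.edgeSet, D.arc e

/-- `F` is a face of the drawing: a connected component of the complement of the drawing. -/
def PlaneEmbedding.IsFace {V : Type*} {G : SimpleGraph V} (D : G.PlaneEmbedding)
    (F : Set Plane) : Prop :=
  ∃ x ∈ D.carrierᶜ, F = connectedComponentIn D.carrierᶜ x

/-- `F` is the outer face of the drawing: the unbounded face. -/
def PlaneEmbedding.IsOuterFace {V : Type*} {G : SimpleGraph V} (D : G.PlaneEmbedding)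
    (F : Set Plane) : Prop :=
  D.IsFace F ∧ ¬ Bornology.IsBounded F

/-- `G` is outerplanar: it has a crossing-free drawing in the plane such that all vertices lie on
the boundary of the outer face. -/
def IsOuterplanar {V : Type*} (G : SimpleGraph V) : Prop :=
  ∃ D : G.PlaneEmbedding, ∃ F : Set Plane, D.IsOuterFace F ∧ ∀ v : V, D.pos v ∈ frontier F

/-- `G` is maximal outerplanar: it is outerplanar, and adding an edge between any two distinct
non-adjacent vertices gives a graph that is not outerplanar. -/
def IsMaximalOuterplanar {V : Type*} (G : SimpleGraph V) : Prop :=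
  G.IsOuterplanar ∧
    ∀ u v : V, u ≠ v → ¬ G.Adj u v → ¬ (G ⊔ SimpleGraph.edge u v).IsOuterplanar

/-- `S` is a total dominating set of `G`: every vertex is adjacent to some vertex in `S`. -/
def IsTotalDominatingSet {V : Type*} (G : SimpleGraph V) (S : Set V) : Prop :=
  ∀ v : V, ∃ u ∈ S, G.Adj v u

/-- `S` is a secure total dominating set of `G`: it is a total dominating set, and every `u ∉ S`
has a neighbour `v ∈ S` such that `(S \ {v}) ∪ {u}` is a total dominating set. -/
def IsSecureTotalDominatingSet {V : Type*} (G : SimpleGraph V) (S : Set V) : Prop :=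
  G.IsTotalDominatingSet S ∧
    ∀ u, u ∉ S → ∃ v ∈ S, G.Adj u v ∧ G.IsTotalDominatingSet ((S \ {v}) ∪ {u})

/-- The secure total domination number: the smallest cardinality of a secure total dominating set,
and `⊤` if there is no such set. -/
noncomputable def secureTotalDominationNumber {V : Type*} (G : SimpleGraph V) : ℕ∞ :=
  ⨅ S ∈ {S : Set V | G.IsSecureTotalDominatingSet S}, S.encard

end SimpleGraph

/-!
Every maximal outerplanar graph on at least three vertices contains a triangulated polygon through
all its vertices, and a triangulated polygon has a secure total dominating set of at most two thirds
of its vertices by induction, with reductions near the leaves of the dual tree.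

*From the plane to a circular order.* Let the paths `e` and `f` be disjoint. Then `e s - f t` has a
continuous logarithm on the square, and the sum of its increments around the square vanishes. When
these increments are compared with the principal logarithm, there results a relation between
integers that belong to pairs of a point and a path, and to pairs of points
(`exists_edge_invariant`). In a drawing of `K₃,₃` or `K₅` whose independent edges are disjoint, the
sum of all these relations is contradictory modulo 2 (`not_disjoint_joinedIn_k33`,
`not_disjoint_joinedIn_k5`). This needs neither the Jordan curve theorem nor any regularity of the
arcs, and nothing is required of edges with a common end. So a point of the outer face can be used
as a further vertex, joined to each vertex `w` within the union of the face and a small disc around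
`w`, and an outerplanar graph contains neither a subdivision of `K₂,₃` nor a `K₄`
(`IsOuterplanar.not_theta`, `IsOuterplanar.not_k4`). From this it follows, with a longest cycle and
with the components attached to it at cut vertices, that the vertices have a circular order in which
no two edges cross (`IsOuterplanar.hasNoncrossingOrder`).

*Maximality.* Conversely, a graph with a noncrossing order is outerplanar: place the vertices on a
parabola and draw straight edges (`isOuterplanar_of_noncrossing`). In a maximal outerplanar graph
every missing edge is therefore crossed by some edge, which makes the graph a triangulated polygon
(`IsMaximalOuterplanar.exists_polygon`). It is encoded by a binary tree whose nodes are the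
triangles and are labelled by their apexes; a subtree is a side of the polygon that a chord cuts
off.

*Domination.* Let a chord cut off a polygon `s`, and let a secure total dominating set `S'` of the
graph with a smaller polygon `s'` in place of `s` be given. Whether a set `Y` of vertices of `s` can
take the place of the part of `S'` in `s'` depends on `s`, `s'` and this part only
(`SecurelyDominates.replace`). A finite table of pairs of shapes of `s` and `s'`, with a set `Y` for
each part that can occur, is verified by computation (`reducesMask_of_mem`): for `d` vertices more
in `s`, the set grows by at most `2d/3`. Five shapes are not in the table, and a tree both of whose
subtrees have one of these five shapes either has one itself or is in the table (`node_mem`). So the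
induction reaches every triangulated polygon (`exists_securelyDominates`).
-/

/-! ### Disjoint paths in the plane and the nonplanarity of `K₃,₃` and `K₅` -/

open Complex in
/-- A continuous function without zeros on a simply connected, locally path connected space has a
continuous logarithm. -/
theorem exists_continuous_exp_eq {X : Type*} [TopologicalSpace X] [LocallyPathConnectedSpace X]
    [SimplyConnectedSpace X] {g : X → ℂ} (hg : Continuous g) (h0 : ∀ x, g x ≠ 0) :
    ∃ L : X → ℂ, Continuous L ∧ ∀ x, exp (L x) = g x := by
  obtain ⟨L, hL, hLg⟩ := exists_continuousOn_eqOn_exp_comp (U := (Set.univ : Set X))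
    (Homeomorph.Set.univ X).toHomotopyEquiv.simplyConnectedSpace isOpen_univ
    hg.continuousOn (by rintro ⟨x, -, hx⟩; exact h0 x hx)
  exact ⟨L, continuousOn_univ.1 hL, fun x => hLg (Set.mem_univ x)⟩

/-- The increment of a continuous logarithm of `p - f` over the unit interval; it is `0` if there is
no such logarithm, which happens only if `f` is discontinuous or passes through `p`. Paths are
functions on the whole real line, and only their values on the unit interval matter in the end. -/
noncomputable def logIncrement (p : ℂ) (f : ℝ → ℂ) : ℂ :=
  open Classical in
  if h : ∃ L : ℝ → ℂ, Continuous L ∧ ∀ t, Complex.exp (L t) = p - f t then h.choose 1 - h.choose 0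
  else 0

/-- The increments of a continuous logarithm do not depend on its choice: two logarithms differ by
an integer multiple of `2πi`, which is constant by continuity. -/
theorem sub_eq_sub_of_exp_eq {L M : ℝ → ℂ} (hL : Continuous L) (hM : Continuous M)
    (h : ∀ t, Complex.exp (L t) = Complex.exp (M t)) (a b : ℝ) : L a - L b = M a - M b := by
  have key : ∀ t, ∃ n : ℤ, L t - M t = n * (2 * Real.pi * Complex.I) := fun t => by
    obtain ⟨n, hn⟩ := Complex.exp_eq_exp_iff_exists_int.1 (h t)
    exact ⟨n, by rw [hn]; ring⟩
  choose n hn using key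
  have hpi : (2 * Real.pi * Complex.I : ℂ) ≠ 0 := Complex.two_pi_I_ne_zero
  have hc : Continuous fun t => ((n t : ℝ)) := by
    have h1 : Continuous fun t => ((L t - M t) / (2 * Real.pi * Complex.I)).re := by fun_prop
    convert h1 using 2 with t
    rw [hn t, mul_div_cancel_right₀ _ hpi]
    simp
  have hc' : Continuous n := Int.isClosedEmbedding_coe_real.isEmbedding.continuous_iff.2 hc
  have hab : n a = n b := PreconnectedSpace.constant inferInstance hc'
  have ha := hn a
  have hb := hn b
  rw [hab] at ha
  linear_combination ha - hb

theorem logIncrement_eq {p : ℂ} {f L : ℝ → ℂ} (hL : Continuous L)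
    (h : ∀ t, Complex.exp (L t) = p - f t) : logIncrement p f = L 1 - L 0 := by
  have hex : ∃ L : ℝ → ℂ, Continuous L ∧ ∀ t, Complex.exp (L t) = p - f t := ⟨L, hL, h⟩
  rw [logIncrement, dif_pos hex]
  exact sub_eq_sub_of_exp_eq hex.choose_spec.1 hL (fun t => by rw [hex.choose_spec.2, h]) 1 0

/-- For two disjoint paths `e` and `f`, the function `e s - f t` has a continuous logarithm on the
plane, so that its increments along the four sides of the square `[0, 1] × [0, 1]` add up to zero.
The sides on which `f` is constant give the increments of `log (f t - e s)`, which are those of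
`log (e s - f t)`. -/
theorem logIncrement_square {e f : ℝ → ℂ} (he : Continuous e) (hf : Continuous f)
    (hef : ∀ s t, e s ≠ f t) :
    logIncrement (e 0) f - logIncrement (e 1) f + logIncrement (f 1) e - logIncrement (f 0) e
      = 0 := by
  obtain ⟨L, hL, hLe⟩ := exists_continuous_exp_eq (X := ℝ × ℝ) (g := fun x => e x.1 - f x.2)
    (by fun_prop) (fun x => sub_ne_zero.2 (hef _ _))
  have h1 : ∀ s, logIncrement (e s) f = L (s, 1) - L (s, 0) := fun s =>
    logIncrement_eq (L := fun t => L (s, t)) (by fun_prop) (fun t => hLe (s, t))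
  have h2 : ∀ t, logIncrement (f t) e = L (1, t) - L (0, t) := fun t => by
    rw [logIncrement_eq (L := fun s => L (s, t) + Real.pi * Complex.I) (by fun_prop) (fun s => by
      rw [Complex.exp_add, hLe, Complex.exp_pi_mul_I]; ring)]
    ring
  rw [h1, h1, h2, h2]
  ring

/-- The increment agrees with that of the principal logarithm up to a multiple of `2πi`. -/
theorem exists_logIncrement_int {p : ℂ} {f : ℝ → ℂ} (hf : Continuous f) (hp : ∀ t, p ≠ f t) :
    ∃ n : ℤ, logIncrement p f =
      Complex.log (p - f 1) - Complex.log (p - f 0) + n * (2 * Real.pi * Complex.I) := by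
  obtain ⟨L, hL, hLe⟩ := exists_continuous_exp_eq (X := ℝ) (g := fun x => p - f x)
    (by fun_prop) (fun x => sub_ne_zero.2 (hp _))
  have key : ∀ t, ∃ n : ℤ, L t = Complex.log (p - f t) + n * (2 * Real.pi * Complex.I) := by
    intro t
    apply Complex.exp_eq_exp_iff_exists_int.1
    rw [hLe, Complex.exp_log (sub_ne_zero.2 (hp _))]
  obtain ⟨n1, h1⟩ := key 1
  obtain ⟨n0, h0⟩ := key 0
  refine ⟨n1 - n0, ?_⟩
  rw [logIncrement_eq hL hLe, h1, h0]
  push_cast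
  ring

/-- The integer `n` for which the increment of a continuous logarithm of `p - f` is that of the
principal logarithm plus `2πi n`; it is `0` if there is no such integer. -/
noncomputable def windingDefect (p : ℂ) (f : ℝ → ℂ) : ℤ :=
  open Classical in
  if h : ∃ n : ℤ, logIncrement p f =
      Complex.log (p - f 1) - Complex.log (p - f 0) + n * (2 * Real.pi * Complex.I) then h.choose
  else 0

theorem logIncrement_eq_windingDefect {p : ℂ} {f : ℝ → ℂ} (hf : Continuous f)
    (hp : ∀ t, p ≠ f t) : logIncrement p f = Complex.log (p - f 1) - Complex.log (p - f 0) +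
      windingDefect p f * (2 * Real.pi * Complex.I) := by
  have h := exists_logIncrement_int hf hp
  rw [windingDefect, dif_pos h]
  exact h.choose_spec

open Classical in
/-- The indicator of the set of all `z` with positive argument: the open upper half-plane together
with the negative real axis. -/
noncomputable def upperSign (z : ℂ) : ℤ := if 0 < z.arg then 1 else 0

theorem log_neg_eq {z : ℂ} (hz : z ≠ 0) :
    Complex.log (-z) = Complex.log z + (1 - 2 * upperSign z) * (Real.pi * Complex.I) := by
  have harg : ((-z).arg : ℝ) = z.arg + (1 - 2 * upperSign z) * Real.pi := by
    unfold upperSign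
    split_ifs with h
    · rcases lt_or_eq_of_le (Complex.arg_nonneg_iff.1 h.le) with him | him
      · rw [Complex.arg_neg_eq_arg_sub_pi_of_im_pos him]; push_cast; ring
      · have hre : z.re < 0 := by
          by_contra hre
          push Not at hre
          have := Complex.arg_eq_zero_iff.2 ⟨hre, him.symm⟩
          rw [this] at h
          exact lt_irrefl _ h
        rw [Complex.arg_neg_eq_arg_sub_pi_iff.2 (Or.inr ⟨him.symm, hre⟩)]; push_cast; ring
    · have him : z.im ≤ 0 := by
        by_contra him
        push Not at him
        apply h
        refine lt_of_le_of_ne (Complex.arg_nonneg_iff.2 him.le) fun h0 => ?_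
        exact him.ne' (Complex.arg_eq_zero_iff.1 h0.symm).2
      rcases lt_or_eq_of_le him with him | him
      · rw [Complex.arg_neg_eq_arg_add_pi_of_im_neg him]; push_cast; ring
      · have hre : 0 < z.re := by
          by_contra hre
          push Not at hre
          have hre' : z.re < 0 := lt_of_le_of_ne hre fun h0 => hz (Complex.ext h0 him)
          rw [Complex.arg_eq_pi_iff.2 ⟨hre', him⟩] at h
          exact h Real.pi_pos
        rw [Complex.arg_neg_eq_arg_add_pi_iff.2 (Or.inr ⟨him, hre⟩)]; push_cast; ring
  rw [Complex.log, Complex.log, norm_neg, harg]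
  push_cast
  ring

theorem upperSign_add_upperSign_neg {z : ℂ} (hz : z ≠ 0) :
    upperSign z + upperSign (-z) = 1 := by
  have h1 := log_neg_eq hz
  have h2 := log_neg_eq (neg_ne_zero.2 hz)
  rw [neg_neg] at h2
  have hpi : (Real.pi * Complex.I : ℂ) ≠ 0 :=
    mul_ne_zero (by exact_mod_cast Real.pi_ne_zero) Complex.I_ne_zero
  have : ((1 - 2 * upperSign z) + (1 - 2 * upperSign (-z)) : ℂ) = 0 := by
    apply (mul_eq_zero.1 _).resolve_right hpi
    linear_combination -h1 - h2
  have h3 : (1 - 2 * upperSign z) + (1 - 2 * upperSign (-z)) = 0 := by exact_mod_cast this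
  omega

/-- The relation `logIncrement_square` in integers. Its right-hand side depends only on the four end
points of the two paths. -/
theorem windingDefect_square {e f : ℝ → ℂ} (he : Continuous e) (hf : Continuous f)
    (hef : ∀ s t, e s ≠ f t) :
    windingDefect (e 0) f - windingDefect (e 1) f + windingDefect (f 1) e - windingDefect (f 0) e =
      - upperSign (e 0 - f 1) + upperSign (e 0 - f 0) + upperSign (e 1 - f 1)
        - upperSign (e 1 - f 0) := by
  have h := logIncrement_square he hf hef
  have hsq : ∀ s t, Complex.log (f t - e s) = Complex.log (e s - f t) +
      (1 - 2 * upperSign (e s - f t)) * (Real.pi * Complex.I) := fun s t => by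
    rw [← log_neg_eq (sub_ne_zero.2 (hef s t)), neg_sub]
  rw [logIncrement_eq_windingDefect hf (hef 0), logIncrement_eq_windingDefect hf (hef 1),
    logIncrement_eq_windingDefect he (fun s => (hef s 1).symm),
    logIncrement_eq_windingDefect he (fun s => (hef s 0).symm), hsq, hsq, hsq, hsq] at h
  have hpi : (2 * Real.pi * Complex.I : ℂ) ≠ 0 := Complex.two_pi_I_ne_zero
  have h2 : ((windingDefect (e 0) f - windingDefect (e 1) f + windingDefect (f 1) e
      - windingDefect (f 0) e - (- upperSign (e 0 - f 1) + upperSign (e 0 - f 0)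
      + upperSign (e 1 - f 1) - upperSign (e 1 - f 0)) : ℤ) : ℂ) = 0 := by
    apply (mul_eq_zero.1 _).resolve_right hpi
    push_cast
    linear_combination h
  have h3 := Int.cast_eq_zero.1 h2
  omega

/-- The arithmetic content of the winding numbers: integers `s p q` for pairs of points and `n p f`
for a point and a path, which satisfy one linear relation for each pair of disjoint paths. -/
theorem exists_edge_invariant : ∃ (s : ℂ → ℂ → ℤ) (n : ℂ → (ℝ → ℂ) → ℤ),
    (∀ p q, p ≠ q → s p q + s q p = 1) ∧
    ∀ e f : ℝ → ℂ, Continuous e → Continuous f → (∀ s t, e s ≠ f t) →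
      n (e 0) f - n (e 1) f + n (f 1) e - n (f 0) e =
        - s (e 0) (f 1) + s (e 0) (f 0) + s (e 1) (f 1) - s (e 1) (f 0) :=
  ⟨fun p q => upperSign (p - q), windingDefect, fun p q h => by
    simpa using upperSign_add_upperSign_neg (sub_ne_zero.2 h),
    fun _ _ he hf h => windingDefect_square he hf h⟩

theorem JoinedIn.exists_continuous_real {X : Type*} [TopologicalSpace X] {S : Set X} {x y : X}
    (h : JoinedIn S x y) :
    ∃ f : ℝ → X, Continuous f ∧ f 0 = x ∧ f 1 = y ∧ ∀ t, f t ∈ S := by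
  refine ⟨h.somePath.extend, h.somePath.continuous_extend, by simp, by simp, fun t => ?_⟩
  exact h.somePath_mem _

/-- There is no drawing of `K₃,₃` in which edges without a common end are disjoint. The 18 pairs of
such edges give 18 relations as in `exists_edge_invariant`. In their sum modulo 2 each `n p f`
cancels, because the number of edges disjoint from `f` at `p` is even, whereas the terms `s` add up
to an odd number. -/
theorem not_disjoint_joinedIn_k33 (p q : Fin 3 → ℂ) (E : Fin 3 → Fin 3 → Set ℂ)
    (hE : ∀ i j, JoinedIn (E i j) (p i) (q j))
    (hd : ∀ i j i' j', i ≠ i' → j ≠ j' → Disjoint (E i j) (E i' j')) : False := by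
  choose f hfc hf0 hf1 hfE using fun i j => (hE i j).exists_continuous_real
  obtain ⟨s, n, hs, hn⟩ := exists_edge_invariant
  have hq : ∀ j j', j ≠ j' → s (q j) (q j') + s (q j') (q j) = 1 := by
    intro j j' hj
    apply hs
    have := (hd 0 j 1 j' (by decide) hj).ne_of_mem (hfE 0 j 1) (hfE 1 j' 1)
    rwa [hf1, hf1] at this
  have key : ∀ i j i' j', i ≠ i' → j ≠ j' →
      n (p i) (f i' j') - n (q j) (f i' j') + n (q j') (f i j) - n (p i') (f i j) =
        - s (p i) (q j') + s (p i) (p i') + s (q j) (q j') - s (q j) (p i') := by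
    intro i j i' j' hi hj
    have := hn (f i j) (f i' j') (hfc _ _) (hfc _ _)
      (fun a b => (hd i j i' j' hi hj).ne_of_mem (hfE i j a) (hfE i' j' b))
    simpa only [hf0, hf1] using this
  have q01 := hq 0 1 (by decide)
  have q02 := hq 0 2 (by decide)
  have q12 := hq 1 2 (by decide)
  -- the sum of these 18 relations is contradictory modulo 2
  have k1 := key 0 0 1 1 (by decide) (by decide)
  have k2 := key 0 0 1 2 (by decide) (by decide)
  have k3 := key 0 1 1 0 (by decide) (by decide)
  have k4 := key 0 1 1 2 (by decide) (by decide)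
  have k5 := key 0 2 1 0 (by decide) (by decide)
  have k6 := key 0 2 1 1 (by decide) (by decide)
  have k7 := key 0 0 2 1 (by decide) (by decide)
  have k8 := key 0 0 2 2 (by decide) (by decide)
  have k9 := key 0 1 2 0 (by decide) (by decide)
  have k10 := key 0 1 2 2 (by decide) (by decide)
  have k11 := key 0 2 2 0 (by decide) (by decide)
  have k12 := key 0 2 2 1 (by decide) (by decide)
  have k13 := key 1 0 2 1 (by decide) (by decide)
  have k14 := key 1 0 2 2 (by decide) (by decide)
  have k15 := key 1 1 2 0 (by decide) (by decide)
  have k16 := key 1 1 2 2 (by decide) (by decide)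
  have k17 := key 1 2 2 0 (by decide) (by decide)
  have k18 := key 1 2 2 1 (by decide) (by decide)
  omega

/-- There is no drawing of `K₅` in which edges without a common end are disjoint, for the same
reason as for `K₃,₃`; here there are 15 pairs of such edges. -/
theorem not_disjoint_joinedIn_k5 (p : Fin 5 → ℂ) (E : Fin 5 → Fin 5 → Set ℂ)
    (hE : ∀ i j, i < j → JoinedIn (E i j) (p i) (p j))
    (hd : ∀ i j i' j', i < j → i' < j' → i < i' → j ≠ i' → j ≠ j' →
      Disjoint (E i j) (E i' j')) : False := by
  have hE' : ∀ i j, ∃ f : ℝ → ℂ, i < j → Continuous f ∧ f 0 = p i ∧ f 1 = p j ∧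
      ∀ t, f t ∈ E i j := fun i j => by
    by_cases h : i < j
    · obtain ⟨f, hf⟩ := (hE i j h).exists_continuous_real
      exact ⟨f, fun _ => hf⟩
    · exact ⟨fun _ => 0, fun h' => absurd h' h⟩
  choose f hf using hE'
  obtain ⟨s, n, hs, hn⟩ := exists_edge_invariant
  have key : ∀ i j i' j', i < j → i' < j' → i < i' → j ≠ i' → j ≠ j' →
      n (p i) (f i' j') - n (p j) (f i' j') + n (p j') (f i j) - n (p i') (f i j) =
        - s (p i) (p j') + s (p i) (p i') + s (p j) (p j') - s (p j) (p i') ∧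
        s (p j) (p i') + s (p i') (p j) = 1 ∧ s (p j) (p j') + s (p j') (p j) = 1 := by
    intro i j i' j' hij hij' hi hj hj'
    obtain ⟨hc, h0, h1, hm⟩ := hf i j hij
    obtain ⟨hc', h0', h1', hm'⟩ := hf i' j' hij'
    have hdis := hd i j i' j' hij hij' hi hj hj'
    have := hn (f i j) (f i' j') hc hc' (fun a b => hdis.ne_of_mem (hm a) (hm' b))
    rw [h0, h0', h1, h1'] at this
    refine ⟨this, hs _ _ ?_, hs _ _ ?_⟩
    · rw [← h1, ← h0']
      exact hdis.ne_of_mem (hm 1) (hm' 0)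
    · rw [← h1, ← h1']
      exact hdis.ne_of_mem (hm 1) (hm' 1)
  -- the sum of these 15 relations is contradictory modulo 2
  have a1 := key 0 1 2 3 (by decide) (by decide) (by decide) (by decide) (by decide)
  have a2 := key 0 1 2 4 (by decide) (by decide) (by decide) (by decide) (by decide)
  have a3 := key 0 1 3 4 (by decide) (by decide) (by decide) (by decide) (by decide)
  have a4 := key 0 2 1 3 (by decide) (by decide) (by decide) (by decide) (by decide)
  have a5 := key 0 2 1 4 (by decide) (by decide) (by decide) (by decide) (by decide)
  have a6 := key 0 2 3 4 (by decide) (by decide) (by decide) (by decide) (by decide)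
  have a7 := key 0 3 1 2 (by decide) (by decide) (by decide) (by decide) (by decide)
  have a8 := key 0 3 1 4 (by decide) (by decide) (by decide) (by decide) (by decide)
  have a9 := key 0 3 2 4 (by decide) (by decide) (by decide) (by decide) (by decide)
  have b1 := key 0 4 1 2 (by decide) (by decide) (by decide) (by decide) (by decide)
  have b2 := key 0 4 1 3 (by decide) (by decide) (by decide) (by decide) (by decide)
  have b3 := key 0 4 2 3 (by decide) (by decide) (by decide) (by decide) (by decide)
  have b4 := key 1 2 3 4 (by decide) (by decide) (by decide) (by decide) (by decide)
  have b5 := key 1 3 2 4 (by decide) (by decide) (by decide) (by decide) (by decide)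
  have b6 := key 1 4 2 3 (by decide) (by decide) (by decide) (by decide) (by decide)
  omega

/-! ### Forbidden subgraphs of outerplanar graphs -/

namespace SimpleGraph

/-- The plane as the complex numbers. -/
noncomputable def planeToComplex (p : Plane) : ℂ := ⟨p 0, p 1⟩

theorem continuous_planeToComplex : Continuous planeToComplex := by
  have : planeToComplex = fun p : Plane => ((p 0 : ℝ) : ℂ) + ((p 1 : ℝ) : ℂ) * Complex.I := by
    funext p
    apply Complex.ext <;> simp [planeToComplex]
  rw [this]
  fun_prop

theorem planeToComplex_injective : Function.Injective planeToComplex := by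
  intro p q h
  have h0 := congrArg Complex.re h
  have h1 := congrArg Complex.im h
  ext i
  fin_cases i
  · exact h0
  · exact h1

theorem IsSimpleArc.joinedIn {A : Set Plane} {x y : Plane} (h : IsSimpleArc A x y) :
    JoinedIn A x y := by
  obtain ⟨γ, hc, -, h0, h1, rfl⟩ := h
  exact ⟨⟨⟨γ, hc⟩, h0, h1⟩, fun t => ⟨t, rfl⟩⟩

theorem IsSimpleArc.isCompact {A : Set Plane} {x y : Plane} (h : IsSimpleArc A x y) :
    IsCompact A := by
  obtain ⟨γ, hc, -, -, -, rfl⟩ := h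
  exact isCompact_range hc

/-- A point in the closure of a region can be reached from it through a small ball around the
point. Nothing is said about reaching it through the region alone, which would require
accessibility of boundary points. -/
theorem joinedIn_union_ball {F : Set Plane} (hFo : IsOpen F) (hFc : IsConnected F) {h w : Plane}
    (hh : h ∈ F) (hw : w ∈ closure F) {r : ℝ} (hr : 0 < r) :
    JoinedIn (F ∪ Metric.ball w r) h w := by
  obtain ⟨p, hpF, hp⟩ := Metric.mem_closure_iff.1 hw r hr
  have h1 : JoinedIn F h p := (hFo.isConnected_iff_isPathConnected.1 hFc).joinedIn h hh p hpF
  have h2 : JoinedIn (Metric.ball w r) p w :=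
    ((convex_ball w r).isPathConnected ⟨w, Metric.mem_ball_self hr⟩).joinedIn p
      (by rwa [Metric.mem_ball, _root_.dist_comm]) w (Metric.mem_ball_self hr)
  exact (h1.mono Set.subset_union_left).trans (h2.mono Set.subset_union_right)

namespace PlaneEmbedding
variable {V : Type*} {G : SimpleGraph V} (D : G.PlaneEmbedding)

/-- The part of the drawing that shows the subgraph induced by `X`: the points of the vertices in
`X` and the arcs of the edges with both ends in `X`. -/
def region (X : Set V) : Set Plane :=
  D.pos '' X ∪ ⋃ e ∈ {e ∈ G.edgeSet | ∀ v ∈ e, v ∈ X}, D.arc e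

theorem region_mono {X Y : Set V} (h : X ⊆ Y) : D.region X ⊆ D.region Y := by
  apply Set.union_subset_union (Set.image_mono h)
  apply Set.biUnion_subset_biUnion_left
  exact fun e he => ⟨he.1, fun v hv => h (he.2 v hv)⟩

theorem region_subset_carrier (X : Set V) : D.region X ⊆ D.carrier := by
  apply Set.union_subset_union (Set.image_subset_range _ _)
  apply Set.biUnion_subset_biUnion_left
  exact fun e he => he.1

theorem pos_mem_region {X : Set V} {v : V} : D.pos v ∈ D.region X ↔ v ∈ X := by
  constructor
  · rintro (⟨w, hw, h⟩ | h)
    · rwa [← D.pos_injective h]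
    · simp only [Set.mem_iUnion] at h
      obtain ⟨e, he, hv⟩ := h
      exact he.2 v (D.mem_of_pos_mem_arc e he.1 v hv)
  · exact fun h => Or.inl ⟨v, h, rfl⟩

theorem disjoint_region {X Y : Set V} (h : Disjoint X Y) : Disjoint (D.region X) (D.region Y) := by
  rw [Set.disjoint_left]
  intro p hX hY
  rcases hX with ⟨v, hv, rfl⟩ | hX
  · exact Set.disjoint_left.1 h hv (D.pos_mem_region.1 hY)
  rcases hY with ⟨v, hv, rfl⟩ | hY
  · exact Set.disjoint_left.1 h (D.pos_mem_region.1 (Or.inr hX)) hv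
  simp only [Set.mem_iUnion] at hX hY
  obtain ⟨e, he, hpe⟩ := hX
  obtain ⟨f, hf, hpf⟩ := hY
  have hef : e ≠ f := by
    rintro rfl
    induction e with
    | _ a b => exact Set.disjoint_left.1 h (he.2 a (by simp)) (hf.2 a (by simp))
  obtain ⟨w, hwe, hwf, -⟩ := D.arc_inter_arc e he.1 f hf.1 hef p ⟨hpe, hpf⟩
  exact Set.disjoint_left.1 h (he.2 w hwe) (hf.2 w hwf)

theorem isCompact_arc {e : Sym2 V} (he : e ∈ G.edgeSet) : IsCompact (D.arc e) := by
  induction e with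
  | _ a b => exact (D.isSimpleArc a b he).isCompact

theorem isClosed_region [Finite V] (X : Set V) : IsClosed (D.region X) := by
  apply IsClosed.union ((Set.toFinite _).isClosed)
  exact (Set.toFinite _).isClosed_biUnion fun e he => (D.isCompact_arc he.1).isClosed

theorem carrier_eq_region_univ : D.carrier = D.region Set.univ := by
  simp [carrier, region]

theorem joinedIn_region {X : Set V} {u v : V} (hu : u ∈ X) (hv : v ∈ X) (h : G.Adj u v) :
    JoinedIn (D.region X) (D.pos u) (D.pos v) := by
  refine (D.isSimpleArc u v h).joinedIn.mono fun p hp => Or.inr ?_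
  refine Set.mem_biUnion (x := s(u, v)) ⟨h, ?_⟩ hp
  intro w hw
  rcases Sym2.mem_iff.1 hw with rfl | rfl <;> assumption

theorem joinedIn_region_of_isChain {X : Set V} {v : V} (l : List V) : ∀ u : V,
    List.IsChain G.Adj (u :: l ++ [v]) → (∀ w ∈ u :: l ++ [v], w ∈ X) →
    JoinedIn (D.region X) (D.pos u) (D.pos v) := by
  induction l with
  | nil =>
    intro u h hX
    simp only [List.cons_append, List.nil_append, List.isChain_cons_cons] at h
    exact D.joinedIn_region (hX u (by simp)) (hX v (by simp)) h.1
  | cons a l ih =>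
    intro u h hX
    simp only [List.cons_append, List.isChain_cons_cons] at h
    refine (D.joinedIn_region (hX u (by simp)) (hX a (by simp)) h.1).trans
      (ih a h.2 fun w hw => hX w ?_)
    simp only [List.cons_append, List.mem_cons] at hw ⊢
    tauto

end PlaneEmbedding

/-- `F` is a region in the complement of the drawing `D` that touches all vertices. A point of `F`
serves as an additional vertex adjacent to all others. -/
structure PlaneEmbedding.IsHub {V : Type*} {G : SimpleGraph V} (D : G.PlaneEmbedding)
    (F : Set Plane) : Prop where
  isOpen : IsOpen F
  isConnected : IsConnected F
  disjoint : Disjoint F D.carrier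
  mem_closure : ∀ v, D.pos v ∈ closure F

theorem IsOuterplanar.exists_isHub {V : Type*} [Finite V] {G : SimpleGraph V}
    (h : G.IsOuterplanar) : ∃ (D : G.PlaneEmbedding) (F : Set Plane), D.IsHub F := by
  obtain ⟨D, F, ⟨⟨x, hx, rfl⟩, -⟩, hF⟩ := h
  refine ⟨D, _, ?_, isConnected_connectedComponentIn_iff.2 hx, ?_, fun v => (hF v).1⟩
  · apply IsOpen.connectedComponentIn
    rw [D.carrier_eq_region_univ]
    exact (D.isClosed_region _).isOpen_compl
  · exact Set.disjoint_left.2 fun p hp => connectedComponentIn_subset _ _ hp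

namespace PlaneEmbedding
variable {V : Type*} [Finite V] {G : SimpleGraph V} {D : G.PlaneEmbedding} {F : Set Plane}

/-- A point `h` of the hub is joined to any vertex `w` by a path that avoids all parts of the
drawing without `w`. The set `E` here is the union of the hub and a small ball around `w`; it may
meet edges at `w`, which does no harm because these are never required to be disjoint from it. -/
theorem IsHub.exists_joinedIn (hF : D.IsHub F) {h : Plane} (hh : h ∈ F) (w : V) :
    ∃ E : Set Plane, JoinedIn E h (D.pos w) ∧ ∀ X : Set V, w ∉ X → Disjoint (D.region X) E := by
  have hfin : IsClosed (D.region {w}ᶜ) := D.isClosed_region _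
  have hw : D.pos w ∈ (D.region {w}ᶜ)ᶜ := fun h => D.pos_mem_region.1 h rfl
  obtain ⟨r, hr, hball⟩ := Metric.isOpen_iff.1 hfin.isOpen_compl _ hw
  refine ⟨F ∪ Metric.ball (D.pos w) r,
    joinedIn_union_ball hF.isOpen hF.isConnected hh (hF.mem_closure w) hr, fun X hX => ?_⟩
  apply Disjoint.union_right
  · exact (hF.disjoint.mono_right (D.region_subset_carrier X)).symm
  · refine Set.disjoint_left.2 fun p hp hb => hball hb (D.region_mono ?_ hp)
    exact fun v hv h => hX (h ▸ hv)

end PlaneEmbedding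

theorem not_disjoint_joinedIn_k33_plane (p q : Fin 3 → Plane) (E : Fin 3 → Fin 3 → Set Plane)
    (hE : ∀ i j, JoinedIn (E i j) (p i) (q j))
    (hd : ∀ i j i' j', i < i' → j ≠ j' → Disjoint (E i j) (E i' j')) : False := by
  apply not_disjoint_joinedIn_k33 (fun i => planeToComplex (p i)) (fun i => planeToComplex (q i))
    (fun i j => planeToComplex '' E i j)
  · intro i j
    exact (hE i j).map_continuousOn continuous_planeToComplex.continuousOn
  · intro i j i' j' hi hj
    rw [Set.disjoint_image_iff planeToComplex_injective]
    rcases lt_or_gt_of_ne hi with hi | hi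
    · exact hd _ _ _ _ hi hj
    · exact (hd _ _ _ _ hi hj.symm).symm

theorem not_disjoint_joinedIn_k5_plane (p : Fin 5 → Plane) (E : Fin 5 → Fin 5 → Set Plane)
    (hE : ∀ i j, i < j → JoinedIn (E i j) (p i) (p j))
    (hd : ∀ i j i' j', i < j → i' < j' → i < i' → j ≠ i' → j ≠ j' →
      Disjoint (E i j) (E i' j')) : False := by
  apply not_disjoint_joinedIn_k5 (fun i => planeToComplex (p i))
    (fun i j => planeToComplex '' E i j)
  · intro i j hij
    exact (hE i j hij).map_continuousOn continuous_planeToComplex.continuousOn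
  · intro i j i' j' h1 h2 h3 h4 h5
    rw [Set.disjoint_image_iff planeToComplex_injective]
    exact hd _ _ _ _ h1 h2 h3 h4 h5

/-- An outerplanar graph contains no subdivision of `K₂,₃`: no two vertices `c` and `d` are joined
by three internally disjoint paths with inner vertices `w i :: l i`. With the hub as third vertex of
the first class and the `w i` as second class, they would form a drawing of `K₃,₃` in which edges
without a common end are disjoint. -/
theorem IsOuterplanar.not_theta {V : Type*} [Finite V] {G : SimpleGraph V} (h : G.IsOuterplanar)
    {c d : V} (w : Fin 3 → V) (l : Fin 3 → List V)
    (hchain : ∀ i, List.IsChain G.Adj (c :: w i :: l i ++ [d]))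
    (hc : ∀ i, c ∉ w i :: l i ++ [d]) (hd : ∀ i, d ∉ w i :: l i)
    (hdis : ∀ i j, i ≠ j → List.Disjoint (w i :: l i) (w j :: l j)) : False := by
  obtain ⟨D, F, hF⟩ := h.exists_isHub
  obtain ⟨x, hx⟩ := hF.isConnected.nonempty
  choose E hEj hEd using fun i => hF.exists_joinedIn hx (w i)
  -- the paths from `c` to `w i` and from `w i` to `d` run within these sets of vertices
  let X : Fin 3 → Set V := fun i => {c, w i}
  let Y : Fin 3 → Set V := fun i => {v | v ∈ w i :: l i ++ [d]}
  have hw : ∀ i j, i ≠ j → w i ∉ w j :: l j ++ [d] := by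
    intro i j hij hmem
    rw [List.mem_append] at hmem
    rcases hmem with hmem | hmem
    · exact hdis i j hij (by simp) hmem
    · have : w i = d := by simpa using hmem
      exact hd i (by simp [← this])
  have hXY : ∀ i j, i ≠ j → Disjoint (X i) (Y j) := by
    intro i j hij
    refine Set.disjoint_left.2 ?_
    rintro v (rfl | rfl) hv
    · exact hc j hv
    · exact hw _ j hij hv
  have hwX : ∀ i j, i ≠ j → w i ∉ X j := by
    intro i j hij
    rintro (h | h)
    · exact hc i (by simp [← h])
    · have h : w i = w j := h
      exact hdis i j hij (a := w i) (by simp) (by rw [h]; simp)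
  apply not_disjoint_joinedIn_k33_plane ![D.pos c, D.pos d, x] (fun i => D.pos (w i))
    ![fun i => D.region (X i), fun i => D.region (Y i), E]
  · intro i j
    fin_cases i
    · have := hchain j
      simp only [List.cons_append, List.isChain_cons_cons] at this
      exact D.joinedIn_region (by simp [X]) (by simp [X]) this.1
    · have := hchain j
      simp only [List.cons_append, List.isChain_cons_cons] at this
      exact (D.joinedIn_region_of_isChain (l j) (w j) this.2 fun v hv => hv).symm
    · exact hEj j
  · intro i j i' j' hi hj
    fin_cases i <;> fin_cases i' <;> first | exact absurd hi (by decide) | skip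
    · exact D.disjoint_region (hXY j j' hj)
    · exact hEd j' _ (hwX j' j hj.symm)
    · exact hEd j' _ (hw j' j hj.symm)

/-- An outerplanar graph contains no `K₄`, since the hub would extend it to a `K₅`. -/
theorem IsOuterplanar.not_k4 {V : Type*} [Finite V] {G : SimpleGraph V} (h : G.IsOuterplanar)
    (a : Fin 4 → V) (ha : ∀ i j, i < j → G.Adj (a i) (a j)) : False := by
  obtain ⟨D, F, hF⟩ := h.exists_isHub
  obtain ⟨x, hx⟩ := hF.isConnected.nonempty
  choose E hEj hEd using fun i => hF.exists_joinedIn hx (a i)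
  have hne : ∀ i j, i ≠ j → a i ≠ a j := fun i j hij => by
    rcases lt_or_gt_of_ne hij with hij | hij
    · exact (ha i j hij).ne
    · exact (ha j i hij).ne'
  apply not_disjoint_joinedIn_k5_plane (Fin.cons x fun i => D.pos (a i))
    (Fin.cons (Fin.cons ∅ E) fun i => Fin.cons ∅ fun j => D.region {a i, a j})
  · intro i j hij
    induction i using Fin.cases with
    | zero =>
      induction j using Fin.cases with
      | zero => exact absurd hij (lt_irrefl _)
      | succ j => simpa using hEj j
    | succ i =>
      induction j using Fin.cases with
      | zero => exact absurd hij (by simp)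
      | succ j => simpa using D.joinedIn_region (by simp) (by simp) (ha i j (by simpa using hij))
  · intro i j i' j' hij hij' hi hj hj'
    induction i' using Fin.cases with
    | zero => exact absurd hi (by simp)
    | succ i' =>
    induction j' using Fin.cases with
    | zero => exact absurd hij' (by simp)
    | succ j' =>
    induction j using Fin.cases with
    | zero => exact absurd hij (by simp)
    | succ j =>
    have h1 := hne j i' (by simpa using hj)
    have h2 := hne j j' (by simpa using hj')
    induction i using Fin.cases with
    | zero =>
      simpa using (hEd j {a i', a j'} (by simp [h1, h2])).symm
    | succ i =>
      have h3 := hne i i' (by simpa using hi.ne)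
      have h4 := hne i j' (by simpa using (hi.trans hij').ne)
      simpa using D.disjoint_region (X := {a i, a j}) (Y := {a i', a j'})
        (by simp [h1.symm, h2.symm, h3.symm, h4.symm])

end SimpleGraph

/-! ### Outerplanar graphs have a circular order without crossing edges -/

namespace SimpleGraph
variable {V : Type*} {G : SimpleGraph V}

/-- No two edges of `G` cross when the vertices of `l` are placed in this order on a circle. -/
def IsNoncrossing (G : SimpleGraph V) (l : List V) : Prop :=
  ∀ a b c d, [a, b, c, d].Sublist l → G.Adj a c → ¬ G.Adj b d

/-- Being noncrossing depends only on the circular order. -/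
theorem IsNoncrossing.append_comm {l₁ l₂ : List V} (h : G.IsNoncrossing (l₁ ++ l₂)) :
    G.IsNoncrossing (l₂ ++ l₁) := by
  intro a b c d hs hac hbd
  obtain ⟨s, t, hst, hs, ht⟩ := List.sublist_append_iff.1 hs
  have hts : (t ++ s).Sublist (l₁ ++ l₂) := ht.append hs
  rcases s with _ | ⟨x, _ | ⟨y, _ | ⟨z, _ | ⟨w, s⟩⟩⟩⟩ <;> simp at hst
  · subst hst
    exact h a b c d (by simpa using hts) hac hbd
  · obtain ⟨rfl, rfl⟩ := hst
    exact h b c d a hts hbd hac.symm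
  · obtain ⟨rfl, rfl, rfl⟩ := hst
    exact h c d a b hts hac.symm hbd.symm
  · obtain ⟨rfl, rfl, rfl, rfl⟩ := hst
    exact h d a b c hts hbd.symm hac
  · obtain ⟨rfl, rfl, rfl, rfl, rfl, rfl⟩ := hst
    exact h a b c d (by simpa using hts) hac hbd

/-- Circular orders of two pieces that share the vertex `c` only are joined at `c`. -/
theorem IsNoncrossing.glue {c : V} {l₁ l₂ : List V} (h₁ : G.IsNoncrossing (c :: l₁))
    (h₂ : G.IsNoncrossing (c :: l₂)) (h : ∀ x ∈ l₁, ∀ y ∈ l₂, ¬ G.Adj x y) :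
    G.IsNoncrossing (c :: (l₁ ++ l₂)) := by
  intro a b x d hs hac hbd
  rcases List.sublist_cons_iff.1 hs with hs | ⟨r, hr, hs⟩
  · obtain ⟨s, t, hst, hs, ht⟩ := List.sublist_append_iff.1 hs
    rcases s with _ | ⟨x', _ | ⟨y', _ | ⟨z', _ | ⟨w', s⟩⟩⟩⟩ <;> simp at hst
    · subst hst
      exact h₂ a b x d (ht.trans (List.sublist_cons_self _ _)) hac hbd
    · obtain ⟨rfl, rfl⟩ := hst
      exact h a (hs.subset (by simp)) x (ht.subset (by simp)) hac
    · obtain ⟨rfl, rfl, rfl⟩ := hst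
      exact h a (hs.subset (by simp)) x (ht.subset (by simp)) hac
    · obtain ⟨rfl, rfl, rfl, rfl⟩ := hst
      exact h b (hs.subset (by simp)) d (ht.subset (by simp)) hbd
    · obtain ⟨rfl, rfl, rfl, rfl, rfl, rfl⟩ := hst
      exact h₁ a b x d (hs.trans (List.sublist_cons_self _ _)) hac hbd
  · simp only [List.cons.injEq] at hr
    obtain ⟨rfl, rfl⟩ := hr
    obtain ⟨s, t, hst, hs, ht⟩ := List.sublist_append_iff.1 hs
    rcases s with _ | ⟨x', _ | ⟨y', _ | ⟨z', s⟩⟩⟩ <;> simp at hst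
    · subst hst
      exact h₂ a b x d (ht.cons_cons a) hac hbd
    · obtain ⟨rfl, rfl⟩ := hst
      exact h b (hs.subset (by simp)) d (ht.subset (by simp)) hbd
    · obtain ⟨rfl, rfl, rfl⟩ := hst
      exact h b (hs.subset (by simp)) d (ht.subset (by simp)) hbd
    · obtain ⟨rfl, rfl, rfl, rfl, rfl⟩ := hst
      exact h₁ a b x d (hs.cons_cons a) hac hbd

/-- The vertices of `A` have a circular order without crossing edges. -/
def HasNoncrossingOrder (G : SimpleGraph V) (A : Set V) : Prop :=
  ∃ l : List V, l.Nodup ∧ (∀ v, v ∈ l ↔ v ∈ A) ∧ G.IsNoncrossing l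

theorem HasNoncrossingOrder.exists_cons {A : Set V} (h : G.HasNoncrossingOrder A) {c : V}
    (hc : c ∈ A) : ∃ l : List V, (c :: l).Nodup ∧ (∀ v, v ∈ c :: l ↔ v ∈ A) ∧
      G.IsNoncrossing (c :: l) := by
  obtain ⟨l, hl, hA, hn⟩ := h
  obtain ⟨s, t, rfl⟩ := List.append_of_mem ((hA c).2 hc)
  have hp : (c :: (t ++ s)).Perm (s ++ c :: t) :=
    (List.perm_append_comm (l₁ := s) (l₂ := c :: t)).symm
  exact ⟨t ++ s, hp.nodup_iff.2 hl, fun v => by rw [hp.mem_iff, hA], hn.append_comm⟩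

/-- If `A` and `B` have only the vertex `c` in common and no edge joins them elsewhere, then
circular orders of `A` and `B` give one of `A ∪ B`. -/
theorem HasNoncrossingOrder.glue {A B : Set V} {c : V} (hA : G.HasNoncrossingOrder A)
    (hB : G.HasNoncrossingOrder B) (hcA : c ∈ A) (hcB : c ∈ B)
    (hAB : ∀ v, v ∈ A → v ∈ B → v = c)
    (h : ∀ x ∈ A, ∀ y ∈ B, x ≠ c → y ≠ c → ¬ G.Adj x y) : G.HasNoncrossingOrder (A ∪ B) := by
  obtain ⟨l₁, hl₁, h₁, hn₁⟩ := hA.exists_cons hcA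
  obtain ⟨l₂, hl₂, h₂, hn₂⟩ := hB.exists_cons hcB
  rw [List.nodup_cons] at hl₁ hl₂
  have hm₁ : ∀ x ∈ l₁, x ∈ A ∧ x ≠ c := fun x hx =>
    ⟨(h₁ x).1 (by simp [hx]), by rintro rfl; exact hl₁.1 hx⟩
  have hm₂ : ∀ x ∈ l₂, x ∈ B ∧ x ≠ c := fun x hx =>
    ⟨(h₂ x).1 (by simp [hx]), by rintro rfl; exact hl₂.1 hx⟩
  refine ⟨c :: (l₁ ++ l₂), ?_, fun v => ?_, hn₁.glue hn₂ fun x hx y hy =>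
    h x (hm₁ x hx).1 y (hm₂ y hy).1 (hm₁ x hx).2 (hm₂ y hy).2⟩
  · rw [List.nodup_cons, List.mem_append, List.nodup_append]
    exact ⟨fun h => h.elim hl₁.1 hl₂.1, hl₁.2, hl₂.2, fun x hx y hy hxy =>
      (hm₁ x hx).2 (hAB x (hm₁ x hx).1 (hxy ▸ (hm₂ y hy).1))⟩
  · rw [Set.mem_union, ← h₁, ← h₂]
    simp only [List.mem_cons, List.mem_append]
    tauto

/-- The list `c :: t` runs through the vertices of a cycle of `G`; a single edge counts as a cycle
of length two. -/
structure IsCycleList (G : SimpleGraph V) (c : V) (t : List V) : Prop where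
  nodup : (c :: t).Nodup
  isChain : List.IsChain G.Adj (c :: t ++ [c])
  ne_nil : t ≠ []

theorem IsCycleList.rotate {c d : V} {t₁ t₂ : List V} (h : G.IsCycleList c (t₁ ++ d :: t₂)) :
    G.IsCycleList d (t₂ ++ c :: t₁) where
  nodup := by
    have hp : (d :: (t₂ ++ c :: t₁)).Perm (c :: (t₁ ++ d :: t₂)) :=
      List.perm_append_comm (l₁ := d :: t₂) (l₂ := c :: t₁)
    exact hp.nodup_iff.2 h.nodup
  isChain := by
    have h1 : List.IsChain G.Adj ((c :: t₁) ++ d :: (t₂ ++ [c])) := by simpa using h.isChain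
    rw [List.isChain_split] at h1
    have h2 : List.IsChain G.Adj ((d :: t₂) ++ c :: (t₁ ++ [d])) :=
      List.isChain_split.2 ⟨by simpa using h1.2, by simpa using h1.1⟩
    simpa using h2
  ne_nil := by simp

theorem isChain_reverse_adj {l : List V} (h : List.IsChain G.Adj l) :
    List.IsChain G.Adj l.reverse := by
  rw [List.isChain_reverse]
  exact h.imp fun _ _ h => h.symm

/-- `IsOuterplanar.not_theta` for three lists of inner vertices of paths from `c` to `d`. -/
theorem IsOuterplanar.not_theta_lists [Finite V] (hG : G.IsOuterplanar) {c d : V}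
    {l₁ l₂ l₃ : List V} (h₁ : List.IsChain G.Adj (c :: l₁ ++ [d]))
    (h₂ : List.IsChain G.Adj (c :: l₂ ++ [d])) (h₃ : List.IsChain G.Adj (c :: l₃ ++ [d]))
    (hn₁ : l₁ ≠ []) (hn₂ : l₂ ≠ []) (hn₃ : l₃ ≠ [])
    (hnd : (c :: d :: (l₁ ++ l₂ ++ l₃)).Nodup) : False := by
  obtain ⟨w₁, l₁, rfl⟩ := List.exists_cons_of_ne_nil hn₁
  obtain ⟨w₂, l₂, rfl⟩ := List.exists_cons_of_ne_nil hn₂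
  obtain ⟨w₃, l₃, rfl⟩ := List.exists_cons_of_ne_nil hn₃
  simp only [List.nodup_cons, List.nodup_append, List.mem_cons, List.mem_append] at hnd
  apply hG.not_theta (c := c) (d := d) ![w₁, w₂, w₃] ![l₁, l₂, l₃]
  · intro i
    fin_cases i <;> assumption
  · intro i
    fin_cases i <;> simp <;> tauto
  · intro i
    fin_cases i <;> simp <;> tauto
  · obtain ⟨-, -, ⟨-, -, h12⟩, -, h3⟩ := hnd
    have d12 : List.Disjoint (w₁ :: l₁) (w₂ :: l₂) := fun x hx hy =>
      h12 x (by simpa using hx) x (by simpa using hy) rfl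
    have d13 : List.Disjoint (w₁ :: l₁) (w₃ :: l₃) := fun x hx hy =>
      h3 x (Or.inl (by simpa using hx)) x (by simpa using hy) rfl
    have d23 : List.Disjoint (w₂ :: l₂) (w₃ :: l₃) := fun x hx hy =>
      h3 x (Or.inr (by simpa using hx)) x (by simpa using hy) rfl
    intro i j hij
    fin_cases i <;> fin_cases j <;>
      first | exact absurd rfl hij | assumption | (apply List.Disjoint.symm; assumption)

/-- A cycle through `a`, `b`, `c`, `d` with the crossing chords `a c` and `b d` has no inner vertex
on its arc `s₁` from `a` to `b`. Otherwise `a` and `b` would be joined by three internally disjoint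
paths: along `s₁`, along `s₄` and over `d`, and over `c` and along `s₂`. -/
theorem IsOuterplanar.arc_eq_nil [Finite V] (hG : G.IsOuterplanar) {a b c d : V}
    {s₁ s₂ s₃ s₄ : List V}
    (hnd : (a :: s₁ ++ b :: s₂ ++ c :: s₃ ++ d :: s₄).Nodup)
    (h₁ : List.IsChain G.Adj (a :: s₁ ++ [b])) (h₂ : List.IsChain G.Adj (b :: s₂ ++ [c]))
    (h₄ : List.IsChain G.Adj (d :: s₄ ++ [a])) (hac : G.Adj a c) (hbd : G.Adj b d) :
    s₁ = [] := by
  by_contra hne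
  refine hG.not_theta_lists (c := a) (d := b) (l₁ := s₁) (l₂ := s₄.reverse ++ [d])
    (l₃ := c :: s₂.reverse) h₁ ?_ ?_ hne (by simp) (by simp) ?_
  · have := isChain_reverse_adj h₄
    have h : List.IsChain G.Adj ((a :: s₄.reverse) ++ d :: [b]) :=
      List.isChain_split.2 ⟨by simpa using this, by simpa using hbd.symm⟩
    simpa using h
  · have := isChain_reverse_adj h₂
    have h : List.IsChain G.Adj ([a] ++ c :: (s₂.reverse ++ [b])) :=
      List.isChain_split.2 ⟨by simpa using hac, by simpa using this⟩
    simpa using h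
  · simp only [List.nodup_cons, List.nodup_append, List.mem_cons, List.mem_append,
      List.nodup_reverse, List.mem_reverse, List.cons_append, List.append_assoc] at hnd ⊢
    grind

/-- A cycle of an outerplanar graph has no crossing chords: by `IsOuterplanar.arc_eq_nil` all four
arcs between the ends of crossing chords would be single edges, so that the ends form a `K₄`. -/
theorem IsCycleList.isNoncrossing [Finite V] (hG : G.IsOuterplanar) {c : V} {t : List V}
    (h : G.IsCycleList c t) : G.IsNoncrossing (c :: t) := by
  intro x y z w hs hxz hyw
  obtain ⟨r, t₁, h₁, hx, hs⟩ := List.cons_sublist_iff.1 hs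
  obtain ⟨r₂, t₂, rfl, hy, hs⟩ := List.cons_sublist_iff.1 hs
  obtain ⟨r₃, t₃, rfl, hz, hs⟩ := List.cons_sublist_iff.1 hs
  have hw := List.singleton_sublist.1 hs
  obtain ⟨u₀, u₁, rfl⟩ := List.append_of_mem hx
  obtain ⟨v₀, v₁, rfl⟩ := List.append_of_mem hy
  obtain ⟨w₀, w₁, rfl⟩ := List.append_of_mem hz
  obtain ⟨x₀, x₁, rfl⟩ := List.append_of_mem hw
  -- the cycle is rotated so that it starts at the first of the four ends
  have key : ∃ s₁ s₂ s₃ s₄, G.IsCycleList x (s₁ ++ y :: s₂ ++ z :: s₃ ++ w :: s₄) := by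
    rcases u₀ with _ | ⟨u, u₀⟩
    · simp only [List.nil_append, List.cons_append, List.cons.injEq] at h₁
      obtain ⟨rfl, rfl⟩ := h₁
      exact ⟨u₁ ++ v₀, v₁ ++ w₀, w₁ ++ x₀, x₁, by simpa using h⟩
    · simp only [List.cons_append, List.cons.injEq] at h₁
      obtain ⟨rfl, rfl⟩ := h₁
      have h' : G.IsCycleList c (u₀ ++ x :: (u₁ ++ (v₀ ++ y :: v₁ ++ (w₀ ++ z :: w₁ ++
        (x₀ ++ w :: x₁))))) := by simpa using h
      exact ⟨u₁ ++ v₀, v₁ ++ w₀, w₁ ++ x₀, x₁ ++ c :: u₀, by simpa using h'.rotate⟩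
  obtain ⟨s₁, s₂, s₃, s₄, hc⟩ := key
  have hnd : (x :: s₁ ++ y :: s₂ ++ z :: s₃ ++ w :: s₄).Nodup := by simpa using hc.nodup
  have hch : List.IsChain G.Adj ((x :: s₁) ++ y :: (s₂ ++ z :: (s₃ ++ w :: (s₄ ++ [x])))) := by
    simpa using hc.isChain
  obtain ⟨c₁, hch⟩ := List.isChain_split.1 hch
  obtain ⟨c₂, hch⟩ := (List.isChain_split (l₁ := y :: s₂)).1 hch
  obtain ⟨c₃, c₄⟩ := (List.isChain_split (l₁ := z :: s₃)).1 hch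
  have e₁ := hG.arc_eq_nil hnd c₁ c₂ c₄ hxz hyw
  have e₂ := hG.arc_eq_nil (a := y) (b := z) (c := w) (d := x) (s₁ := s₂) (s₂ := s₃) (s₃ := s₄)
    (s₄ := s₁) (by
      refine (List.Perm.nodup_iff ?_).1 hnd
      simpa using List.perm_append_comm (l₁ := x :: s₁) (l₂ := y :: s₂ ++ z :: s₃ ++ w :: s₄))
    c₂ c₃ c₁ hyw hxz.symm
  have e₃ := hG.arc_eq_nil (a := z) (b := w) (c := x) (d := y) (s₁ := s₃) (s₂ := s₄) (s₃ := s₁)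
    (s₄ := s₂) (by
      refine (List.Perm.nodup_iff ?_).1 hnd
      simpa using List.perm_append_comm (l₁ := x :: s₁ ++ y :: s₂) (l₂ := z :: s₃ ++ w :: s₄))
    c₃ c₄ c₂ hxz.symm hyw.symm
  have e₄ := hG.arc_eq_nil (a := w) (b := x) (c := y) (d := z) (s₁ := s₄) (s₂ := s₁) (s₃ := s₂)
    (s₄ := s₃) (by
      refine (List.Perm.nodup_iff ?_).1 hnd
      simpa using List.perm_append_comm (l₁ := x :: s₁ ++ y :: s₂ ++ z :: s₃) (l₂ := w :: s₄))
    c₄ c₁ c₃ hyw.symm hxz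
  subst e₁ e₂ e₃ e₄
  simp only [List.cons_append, List.nil_append, List.isChain_cons_cons, List.isChain_singleton,
    and_true] at c₁ c₂ c₃ c₄
  apply hG.not_k4 ![x, y, z, w]
  intro i j hij
  fin_cases i <;> fin_cases j <;> first | exact absurd hij (by decide) | skip
  exacts [c₁, hxz, c₄.symm, c₂, hyw, c₃]

theorem Reachable.exists_nodup_chain {W : Type*} {H : SimpleGraph W} {u v : W}
    (h : H.Reachable u v) : ∃ l : List W, List.IsChain H.Adj (u :: l) ∧ (u :: l).Nodup ∧
      (u :: l).getLast? = some v := by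
  obtain ⟨p, hp⟩ := h.exists_isPath
  refine ⟨p.support.tail, ?_, ?_, ?_⟩
  · rw [p.cons_tail_support]
    exact p.isChain_adj_support
  · rw [p.cons_tail_support]
    exact hp.support_nodup
  · rw [p.cons_tail_support, List.getLast?_eq_getLast_of_ne_nil p.support_ne_nil,
      p.getLast_support]

/-- No path with inner vertices `e` in `A` outside a longest cycle in `A` joins two vertices `c` and
`d` of this cycle. If `c` and `d` are neighbours on the cycle, it could be made longer by a detour
along `e`; otherwise there would be three internally disjoint paths from `c` to `d`. -/
theorem IsOuterplanar.not_ear [Finite V] (hG : G.IsOuterplanar) {A : Set V} {c d : V}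
    {t₁ t₂ e : List V} (hcyc : G.IsCycleList c (t₁ ++ d :: t₂))
    (hA : ∀ v ∈ c :: (t₁ ++ d :: t₂), v ∈ A)
    (hmax : ∀ c' t', G.IsCycleList c' t' → (∀ v ∈ c' :: t', v ∈ A) →
      t'.length ≤ (t₁ ++ d :: t₂).length)
    (he : e ≠ []) (hea : ∀ v ∈ e, v ∈ A ∧ v ∉ c :: (t₁ ++ d :: t₂)) (hen : e.Nodup)
    (hch : List.IsChain G.Adj (c :: e ++ [d])) : False := by
  have hlen : 0 < e.length := List.length_pos_of_ne_nil he
  have hchain : List.IsChain G.Adj ((c :: t₁) ++ d :: (t₂ ++ [c])) := by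
    simpa using hcyc.isChain
  obtain ⟨c₁, c₂⟩ := List.isChain_split.1 hchain
  have hnd := hcyc.nodup
  have hout : ∀ v ∈ e, v ≠ c ∧ v ∉ t₁ ∧ v ≠ d ∧ v ∉ t₂ := fun v hv => by
    have := (hea v hv).2
    simp only [List.mem_cons, List.mem_append] at this
    tauto
  have hAe : ∀ v ∈ e, v ∈ A := fun v hv => (hea v hv).1
  simp only [List.nodup_cons, List.nodup_append, List.mem_cons, List.mem_append] at hnd
  by_cases ht₁ : t₁ = []
  · subst ht₁
    have := hmax c (e ++ d :: t₂) ⟨?_, ?_, by simp⟩ ?_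
    · simp only [List.length_append, List.length_cons, List.nil_append] at this
      omega
    · simp only [List.nodup_cons, List.nodup_append, List.mem_cons, List.mem_append]
      grind
    · have h : List.IsChain G.Adj ((c :: e) ++ d :: (t₂ ++ [c])) :=
        List.isChain_split.2 ⟨hch, c₂⟩
      simpa using h
    · intro v hv
      simp only [List.mem_cons, List.mem_append] at hv hA
      grind
  by_cases ht₂ : t₂ = []
  · subst ht₂
    have := hmax c (t₁ ++ d :: e.reverse) ⟨?_, ?_, by simp⟩ ?_
    · simp only [List.length_append, List.length_cons, List.length_reverse, List.length_nil] at this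
      omega
    · simp only [List.nodup_cons, List.nodup_append, List.mem_cons, List.mem_append,
        List.nodup_reverse, List.mem_reverse]
      grind
    · have h : List.IsChain G.Adj ((c :: t₁) ++ d :: (e.reverse ++ [c])) :=
        List.isChain_split.2 ⟨c₁, by simpa using isChain_reverse_adj hch⟩
      simpa using h
    · intro v hv
      simp only [List.mem_cons, List.mem_append, List.mem_reverse] at hv hA
      grind
  · refine hG.not_theta_lists (c := c) (d := d) (l₁ := t₁) (l₂ := e) (l₃ := t₂.reverse) c₁ hch
      (by simpa using isChain_reverse_adj c₂) ht₁ he (by simpa using ht₂) ?_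
    simp only [List.nodup_cons, List.nodup_append, List.mem_cons, List.mem_append,
      List.nodup_reverse, List.mem_reverse]
    grind

/-- The induction step for the existence of a noncrossing circular order. If a longest cycle in `A`
does not contain all vertices of `A`, then each component of the rest is attached to it at one
vertex `c` at most by `IsOuterplanar.not_ear`, so that `A` splits at `c` into two smaller sets. -/
theorem IsOuterplanar.hasNoncrossingOrder_of_longest_cycle [Finite V] (hG : G.IsOuterplanar)
    {A : Set V} (ih : ∀ B, B ⊂ A → G.HasNoncrossingOrder B) {c₀ : V} {t₀ : List V}
    (hcyc : G.IsCycleList c₀ t₀) (hA : ∀ v ∈ c₀ :: t₀, v ∈ A)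
    (hmax : ∀ c' t', G.IsCycleList c' t' → (∀ v ∈ c' :: t', v ∈ A) → t'.length ≤ t₀.length) :
    G.HasNoncrossingOrder A := by
  by_cases hall : ∀ v ∈ A, v ∈ c₀ :: t₀
  · exact ⟨c₀ :: t₀, hcyc.nodup, fun v => ⟨hA v, hall v⟩, hcyc.isNoncrossing hG⟩
  push Not at hall
  obtain ⟨v₀, hv₀A, hv₀⟩ := hall
  by_cases hadj : ∃ v c, v ∈ A ∧ v ∉ c₀ :: t₀ ∧ c ∈ c₀ :: t₀ ∧ G.Adj c v
  swap
  · -- no edge leaves the cycle, and any of its vertices serves as `c`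
    push Not at hadj
    obtain ⟨d, t, rfl⟩ := List.exists_cons_of_ne_nil hcyc.ne_nil
    have hdc : d ≠ c₀ := by
      have := hcyc.nodup
      simp only [List.nodup_cons, List.mem_cons] at this
      tauto
    have h1 := ih {v | v ∈ c₀ :: d :: t} ⟨hA, fun h => hv₀ (h hv₀A)⟩
    have h2 := ih {v | v ∈ A ∧ (v = c₀ ∨ v ∉ c₀ :: d :: t)} ⟨fun v hv => hv.1, fun h => by
      have := h (hA d (by simp))
      simp [hdc] at this⟩
    convert h1.glue h2 (c := c₀) (by simp) ⟨hA c₀ (by simp), Or.inl rfl⟩ (fun v hv hv' =>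
      hv'.2.resolve_right fun h => h hv) (fun x hx y hy _ hyc =>
        hadj y x hy.1 (hy.2.resolve_left hyc) hx) using 1
    ext v
    simp only [Set.mem_union, Set.mem_ofPred_eq]
    exact ⟨fun hv => (em (v ∈ c₀ :: d :: t)).imp id fun h => ⟨hv, Or.inr h⟩,
      fun h => h.elim (hA v) fun h => h.1⟩
  obtain ⟨v, c, hvA, hv, hc, hcv⟩ := hadj
  -- the cycle is rotated so that it starts at `c`
  obtain ⟨t, hcyc', hperm⟩ : ∃ t, G.IsCycleList c t ∧ (c :: t).Perm (c₀ :: t₀) := by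
    rcases List.mem_cons.1 hc with rfl | hc
    · exact ⟨t₀, hcyc, List.Perm.refl _⟩
    · obtain ⟨s₁, s₂, rfl⟩ := List.append_of_mem hc
      exact ⟨_, hcyc.rotate, List.perm_append_comm (l₁ := c :: s₂) (l₂ := c₀ :: s₁)⟩
  have hlen : t.length = t₀.length := by simpa using hperm.length_eq
  rw [← hlen] at hmax
  have hmem : ∀ w, w ∈ c₀ :: t₀ ↔ w ∈ c :: t := fun w => hperm.mem_iff.symm
  simp only [hmem] at hA hv
  clear hmem hperm hlen hcyc hv₀ hc
  let B : Set V := {x | x ∈ A ∧ x ∉ c :: t}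
  -- the component of `v` outside the cycle
  let R : Set V := {x | ∃ hx : x ∈ B, (G.induce B).Reachable ⟨v, hvA, hv⟩ ⟨x, hx⟩}
  have hRB : ∀ x ∈ R, x ∈ B := fun x hx => hx.1
  have hvR : v ∈ R := ⟨⟨hvA, hv⟩, Reachable.refl _⟩
  -- an edge from this component to a vertex of the cycle other than `c` would close an ear
  have hR : ∀ x ∈ R, ∀ y ∈ A, y ∉ R → y ≠ c → ¬ G.Adj x y := by
    rintro x ⟨hxB, hx⟩ y hyA hyR hyc hxy
    by_cases hyt : y ∈ c :: t
    · obtain ⟨s₁, s₂, rfl⟩ := List.append_of_mem ((List.mem_cons.1 hyt).resolve_left hyc)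
      obtain ⟨l, hlc, hln, hll⟩ := hx.exists_nodup_chain
      refine hG.not_ear hcyc' hA hmax (e := (⟨v, hvA, hv⟩ :: l).map Subtype.val) (by simp) ?_
        (hln.map Subtype.val_injective) ?_
      · intro w hw
        obtain ⟨w', -, rfl⟩ := List.mem_map.1 hw
        exact w'.2
      · have h1 : List.IsChain G.Adj ((⟨v, hvA, hv⟩ :: l : List B).map Subtype.val) := by
          rw [List.isChain_map]
          exact hlc
        have h2 : ((⟨v, hvA, hv⟩ :: l : List B).map Subtype.val).getLast? = some x := by
          rw [List.getLast?_map, hll]; rfl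
        rw [List.cons_append, List.map_cons, List.cons_append, List.isChain_cons_cons]
        refine ⟨hcv, ?_⟩
        rw [← List.cons_append, ← List.map_cons (f := Subtype.val), List.isChain_append]
        refine ⟨h1, by simp, fun a ha b hb => ?_⟩
        rw [h2] at ha
        simp only [Option.mem_def, Option.some.injEq, List.head?_cons] at ha hb
        rw [← ha, ← hb]
        exact hxy
    · exact hyR ⟨⟨hyA, hyt⟩, hx.trans (Adj.reachable (G := G.induce B)
        (u := ⟨x, hxB⟩) (v := ⟨y, hyA, hyt⟩) hxy)⟩
  obtain ⟨d, t', rfl⟩ := List.exists_cons_of_ne_nil hcyc'.ne_nil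
  have hdc : d ≠ c := by
    have := hcyc'.nodup
    simp only [List.nodup_cons, List.mem_cons] at this
    tauto
  have hcA := hA c (by simp)
  have hcR : c ∉ R := fun h => (hRB c h).2 (by simp)
  have h1 := ih (insert c R) ⟨Set.insert_subset hcA fun x hx => (hRB x hx).1, fun h => by
    rcases h (hA d (by simp)) with h | h
    · exact hdc h
    · exact (hRB d h).2 (by simp)⟩
  have h2 := ih (A \ R) ⟨Set.sdiff_subset, fun h => (h hvA).2 hvR⟩
  convert h1.glue h2 (c := c) (by simp) ⟨hcA, hcR⟩ (fun x hx hx' => hx.resolve_right hx'.2)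
    (fun x hx y hy hxc hyc => hR x (hx.resolve_left hxc) y hy.1 hy.2 hyc) using 1
  ext x
  simp only [Set.mem_union, Set.mem_insert_iff, Set.mem_sdiff]
  constructor
  · intro hx
    by_cases hxR : x ∈ R
    · exact Or.inl (Or.inr hxR)
    · exact Or.inr ⟨hx, hxR⟩
  · rintro ((rfl | h) | h)
    exacts [hcA, (hRB x h).1, h.1]

theorem IsOuterplanar.hasNoncrossingOrder [Finite V] (hG : G.IsOuterplanar) (A : Set V) :
    G.HasNoncrossingOrder A := by
  induction A using WellFoundedLT.induction with
  | _ A ih =>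
    have ih' : ∀ B, B ⊂ A → G.HasNoncrossingOrder B := fun B hB => ih B hB
    by_cases hedge : ∃ u v, u ∈ A ∧ v ∈ A ∧ G.Adj u v
    · obtain ⟨u, v, hu, hv, huv⟩ := hedge
      -- a single edge counts as a cycle, so that there is a longest cycle in `A`
      let P : ℕ → Prop := fun n => ∃ c t, G.IsCycleList c t ∧ (∀ v ∈ c :: t, v ∈ A) ∧ t.length = n
      have hP1 : P 1 := ⟨u, [v], ⟨by simp [huv.ne], by simp [huv, huv.symm], by simp⟩,
        by simp [hu, hv], rfl⟩
      have hb : ∀ n, P n → n ≤ Nat.card V := by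
        rintro n ⟨c, t, h, -, rfl⟩
        have := Fintype.ofFinite V
        have h1 := h.nodup.length_le_card
        rw [List.length_cons] at h1
        rw [Nat.card_eq_fintype_card]
        omega
      classical
      obtain ⟨c, t, h, hA, hlen⟩ := Nat.findGreatest_spec (hb 1 hP1) hP1
      refine hG.hasNoncrossingOrder_of_longest_cycle ih' h hA fun c' t' h' hA' => ?_
      rw [hlen]
      exact Nat.le_findGreatest (hb _ ⟨c', t', h', hA', rfl⟩) ⟨c', t', h', hA', rfl⟩
    · push Not at hedge
      have := Fintype.ofFinite V
      classical
      refine ⟨A.toFinset.toList, Finset.nodup_toList _, fun v => by simp,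
        fun a b c d hs hac _ => hedge a c ?_ ?_ hac⟩
      · simpa using hs.subset (show a ∈ _ by simp)
      · simpa using hs.subset (show c ∈ _ by simp)

end SimpleGraph

/-! ### Straight line drawings with the vertices on a parabola -/

namespace SimpleGraph
variable {V : Type*} {G : SimpleGraph V}

/-- The point with abscissa `t` on the standard parabola. -/
noncomputable def parabola (t : ℝ) : Plane := !₂[t, t ^ 2]

@[simp] theorem parabola_zero (t : ℝ) : parabola t 0 = t := rfl
@[simp] theorem parabola_one (t : ℝ) : parabola t 1 = t ^ 2 := rfl

theorem eq_parabola {p : Plane} (h : p 1 = p 0 ^ 2) : p = parabola (p 0) := by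
  ext i
  fin_cases i
  · rfl
  · exact h

theorem parabola_injective : Function.Injective parabola := fun s t h => by
  simpa using congrArg (fun p : Plane => p 0) h

/-- The height of a point of a chord over the parabola is the product of the horizontal distances
to the two ends of the chord. -/
theorem chord_parabola {a b : ℝ} {p : Plane} (hp : p ∈ segment ℝ (parabola a) (parabola b)) :
    p 1 - p 0 ^ 2 = (p 0 - a) * (b - p 0) ∧ 0 ≤ (p 0 - a) * (b - p 0) := by
  obtain ⟨s, t, hs, ht, hst, rfl⟩ := hp
  simp only [PiLp.add_apply, PiLp.smul_apply, parabola_zero, parabola_one, smul_eq_mul]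
  obtain rfl : s = 1 - t := by linarith
  constructor
  · ring
  · have : ((1 - t) * a + t * b - a) * (b - ((1 - t) * a + t * b)) =
      t * (1 - t) * (b - a) ^ 2 := by ring
    rw [this]
    positivity

/-- If two different chords of the parabola do not cross, then a common point, with abscissa `x`, is
an end of both. By `chord_parabola` the hypothesis `h₂` says that the chords have the same height at
`x`. -/
theorem chords_meet {a b c d x : ℝ} (hab : a < b) (hcd : c < d)
    (h₁ : 0 ≤ (x - a) * (b - x)) (h₂ : (x - a) * (b - x) = (x - c) * (d - x))
    (hne : ¬ (a = c ∧ b = d)) (hx₁ : ¬ (a < c ∧ c < b ∧ b < d)) (hx₂ : ¬ (c < a ∧ a < d ∧ d < b)) :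
    (x = a ∨ x = b) ∧ (x = c ∨ x = d) := by
  have key : ∀ u v : ℝ, u < v → 0 ≤ (x - u) * (v - x) → u ≤ x ∧ x ≤ v := by
    intro u v huv h
    constructor <;> by_contra hlt <;> push Not at hlt <;> nlinarith
  obtain ⟨ha, hb⟩ := key a b hab h₁
  obtain ⟨hc, hd⟩ := key c d hcd (h₂ ▸ h₁)
  rcases lt_trichotomy a c with hac | rfl | hac
  · rcases le_or_gt b c with hbc | hbc
    · exact ⟨Or.inr (by linarith), Or.inl (by linarith)⟩
    · have hdb : d ≤ b := not_lt.1 fun h => hx₁ ⟨hac, hbc, h⟩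
      have h3 : (x - c) * (d - x) ≤ (x - c) * (b - x) :=
        mul_le_mul_of_nonneg_left (by linarith) (by linarith)
      have h4 : (c - a) * (b - x) ≤ 0 := by nlinarith
      have h5 : b - x ≤ 0 := by
        by_contra h
        push Not at h
        nlinarith
      exact ⟨Or.inr (by linarith), Or.inr (by linarith)⟩
  · have hbd : b ≠ d := fun h => hne ⟨rfl, h⟩
    have h3 : (x - a) * (b - d) = 0 := by linarith
    have hxa : x = a := by
      rcases mul_eq_zero.1 h3 with h | h
      · linarith
      · exact absurd (by linarith) hbd
    exact ⟨Or.inl hxa, Or.inl hxa⟩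
  · rcases le_or_gt d a with hda | hda
    · exact ⟨Or.inl (by linarith), Or.inr (by linarith)⟩
    · have hbd : b ≤ d := not_lt.1 fun h => hx₂ ⟨hac, hda, h⟩
      have h3 : (x - a) * (b - x) ≤ (x - a) * (d - x) :=
        mul_le_mul_of_nonneg_left (by linarith) (by linarith)
      have h4 : (a - c) * (d - x) ≤ 0 := by nlinarith
      have h5 : d - x ≤ 0 := by
        by_contra h
        push Not at h
        nlinarith
      exact ⟨Or.inr (by linarith), Or.inr (by linarith)⟩

theorem isSimpleArc_segment {x y : Plane} (h : x ≠ y) : IsSimpleArc (segment ℝ x y) x y := by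
  refine ⟨fun t => AffineMap.lineMap x y (t : ℝ), ?_, ?_, by simp, by simp, ?_⟩
  · exact AffineMap.lineMap_continuous.comp continuous_subtype_val
  · exact (AffineMap.lineMap_injective ℝ h).comp Subtype.val_injective
  · rw [segment_eq_image_lineMap]
    ext p
    simp [Set.mem_image]

/-- The drawing with the vertices on the parabola and straight edges. -/
noncomputable def parabolaEmbedding (f : V → ℝ) (hf : Function.Injective f)
    (hn : ∀ a b c d, f a < f b → f b < f c → f c < f d → G.Adj a c → ¬ G.Adj b d) :
    G.PlaneEmbedding where
  pos v := parabola (f v)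
  arc := Sym2.lift ⟨fun u v => segment ℝ (parabola (f u)) (parabola (f v)),
    fun _ _ => segment_symm ℝ _ _⟩
  pos_injective := parabola_injective.comp hf
  isSimpleArc u v h := isSimpleArc_segment fun h' => h.ne (hf (parabola_injective h'))
  mem_of_pos_mem_arc e he w hw := by
    induction e with
    | _ a b =>
      obtain ⟨h, -⟩ := chord_parabola hw
      simp only [parabola_zero, parabola_one, sub_self] at h
      rw [Sym2.mem_iff]
      rcases mul_eq_zero.1 h.symm with h | h
      · exact Or.inl (hf (by linarith))
      · exact Or.inr (hf (by linarith))
  arc_inter_arc e he e' he' hne p hp := by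
    -- the ends of an edge are named from left to right
    have hord : ∀ e ∈ G.edgeSet, ∃ a b, e = s(a, b) ∧ G.Adj a b ∧ f a < f b := by
      intro e he
      induction e with
      | _ a b =>
        rcases lt_or_gt_of_ne fun h => he.ne (hf h) with h | h
        · exact ⟨a, b, rfl, he, h⟩
        · exact ⟨b, a, Sym2.eq_swap, he.symm, h⟩
    obtain ⟨a, b, rfl, hab, hlt⟩ := hord e he
    obtain ⟨c, d, rfl, hcd, hlt'⟩ := hord e' he'
    obtain ⟨h₁, h₂⟩ := chord_parabola hp.1
    obtain ⟨h₃, -⟩ := chord_parabola hp.2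
    obtain ⟨hl, hr⟩ := chords_meet hlt hlt' h₂ (h₁.symm.trans h₃)
      (fun h => hne (by rw [hf h.1, hf h.2])) (fun h => hn a c b d h.1 h.2.1 h.2.2 hab hcd)
      (fun h => hn c a d b h.1 h.2.1 h.2.2 hcd hab)
    have hpar : ∀ v, p 0 = f v → p = parabola (f v) := fun v hv => by
      rw [← hv]
      apply eq_parabola
      have : (p 0 - f a) * (f b - p 0) = 0 := by
        rcases hl with h | h <;> rw [h] <;> ring
      linarith
    rcases hl with hl | hl
    · refine ⟨a, by simp, ?_, hpar a hl⟩
      rw [Sym2.mem_iff]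
      exact hr.imp (fun h => hf (hl.symm.trans h)) (fun h => hf (hl.symm.trans h))
    · refine ⟨b, by simp, ?_, hpar b hl⟩
      rw [Sym2.mem_iff]
      exact hr.imp (fun h => hf (hl.symm.trans h)) (fun h => hf (hl.symm.trans h))

/-- The part of the plane below the standard parabola. It is unbounded, it lies in the complement of
the drawing, and it has all points of the parabola on its boundary. -/
def belowParabola : Set Plane := {p | p 1 < p 0 ^ 2}

theorem isPreconnected_belowParabola : IsPreconnected belowParabola := by
  have h : belowParabola = (fun q : ℝ × ℝ => (!₂[q.1, q.1 ^ 2 - q.2] : Plane)) ''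
      (Set.univ ×ˢ Set.Ioi 0) := by
    ext p
    simp only [belowParabola, Set.mem_ofPred_eq, Set.mem_image, Set.mem_prod, Set.mem_univ,
      true_and, Set.mem_Ioi, Prod.exists]
    constructor
    · intro hp
      refine ⟨p 0, p 0 ^ 2 - p 1, by linarith, ?_⟩
      ext i
      fin_cases i <;> simp
    · rintro ⟨x, t, ht, rfl⟩
      simpa using ht
  rw [h]
  refine (isPreconnected_univ.prod isPreconnected_Ioi).image _ (Continuous.continuousOn ?_)
  apply (PiLp.continuous_toLp 2 _).comp
  refine continuous_pi fun i => ?_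
  fin_cases i <;> simp <;> fun_prop

theorem not_isBounded_belowParabola : ¬ Bornology.IsBounded belowParabola := by
  intro h
  obtain ⟨C, hC⟩ := h.exists_norm_le
  have hmem : (!₂[0, -(|C| + 1)] : Plane) ∈ belowParabola := by
    simp [belowParabola]
    linarith [abs_nonneg C]
  have h1 := hC _ hmem
  have h2 := PiLp.norm_apply_le (!₂[0, -(|C| + 1)] : Plane) 1
  simp only [Real.norm_eq_abs] at h2
  have h3 : |(-(|C| + 1) : ℝ)| = |C| + 1 := by rw [abs_neg, abs_of_pos (by positivity)]
  have h4 : |(-(|C| + 1) : ℝ)| ≤ C := h2.trans h1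
  linarith [le_abs_self C]

theorem parabola_mem_closure (t : ℝ) : parabola t ∈ closure belowParabola := by
  rw [Metric.mem_closure_iff]
  intro ε hε
  refine ⟨!₂[t, t ^ 2 - ε / 2], ?_, ?_⟩
  · simp [belowParabola, hε]
  · rw [EuclideanSpace.dist_eq]
    simp only [Fin.sum_univ_two, parabola_zero, parabola_one]
    simp
    rw [Real.sqrt_sq (by positivity), abs_of_pos hε]
    linarith

/-- A graph whose vertices can be placed on a line such that no two edges, drawn as arcs above the
line, cross, is outerplanar. -/
theorem isOuterplanar_of_noncrossing (f : V → ℝ) (hf : Function.Injective f)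
    (hn : ∀ a b c d, f a < f b → f b < f c → f c < f d → G.Adj a c → ¬ G.Adj b d) :
    G.IsOuterplanar := by
  let D : G.PlaneEmbedding := parabolaEmbedding f hf hn
  have hbelow : belowParabola ⊆ D.carrierᶜ := by
    intro p hp hpc
    have hp' : p 1 < p 0 ^ 2 := hp
    rcases hpc with ⟨v, rfl⟩ | h
    · exact lt_irrefl _ hp'
    · simp only [Set.mem_iUnion] at h
      obtain ⟨e, -, he⟩ := h
      induction e with
      | _ a b =>
        obtain ⟨h₁, h₂⟩ := chord_parabola (show p ∈ segment ℝ (parabola (f a)) _ from he)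
        linarith
  have hx : (!₂[0, -1] : Plane) ∈ belowParabola := by simp [belowParabola]
  have hsub := isPreconnected_belowParabola.subset_connectedComponentIn hx hbelow
  refine ⟨D, connectedComponentIn D.carrierᶜ !₂[0, -1], ⟨⟨_, hbelow hx, rfl⟩, fun h =>
    not_isBounded_belowParabola (h.subset hsub)⟩, fun v => ⟨?_, fun h => ?_⟩⟩
  · exact closure_mono hsub (parabola_mem_closure (f v))
  · exact connectedComponentIn_subset _ _ (interior_subset h) (Or.inl ⟨v, rfl⟩)

end SimpleGraph

/-! ### Maximal outerplanar graphs are triangulated polygons -/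

/-- Adjacency in a triangulated polygon with a distinguished side `i j`, encoded by a binary tree:
the empty tree stands for the single edge `i j`, and the tree with root `m` and subtrees `l` and `r`
for a triangle `i m j` with the polygon of `l` attached to its side `i m` and that of `r` to its
side `m j`. -/
def polyAdj {α : Type*} : BinaryTree α → α → α → α → α → Prop
  | .nil, i, j, x, y => (x = i ∧ y = j) ∨ (x = j ∧ y = i)
  | .node m l r, i, j, x, y =>
    ((x = i ∧ y = j) ∨ (x = j ∧ y = i)) ∨ polyAdj l i m x y ∨ polyAdj r m j x y

/-- The labels of a binary tree from left to right. These are the vertices of the triangulated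
polygon other than `i` and `j`, in the order from `i` to `j`. -/
def inorder {α : Type*} : BinaryTree α → List α
  | .nil => []
  | .node m l r => inorder l ++ m :: inorder r

namespace SimpleGraph
variable {V : Type*} {G : SimpleGraph V}

/-- `IsOuterplanar.hasNoncrossingOrder` in terms of a numbering of the vertices. -/
theorem IsOuterplanar.exists_equiv_fin [Fintype V] (h : G.IsOuterplanar) :
    ∃ e : V ≃ Fin (Fintype.card V), ∀ a b c d, e a < e b → e b < e c → e c < e d →
      G.Adj a c → ¬ G.Adj b d := by
  classical
  obtain ⟨l, hl, hmem, hn⟩ := h.hasNoncrossingOrder Set.univ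
  have hmem' : ∀ v, v ∈ l := fun v => (hmem v).2 trivial
  let e₀ : Fin l.length ≃ V := hl.getEquivOfForallMemList l hmem'
  have hcard : l.length = Fintype.card V := by simpa using Fintype.card_congr e₀
  refine ⟨e₀.symm.trans (finCongr hcard), fun a b c d hab hbc hcd => hn a b c d ?_⟩
  have hab : e₀.symm a < e₀.symm b := hab
  have hbc : e₀.symm b < e₀.symm c := hbc
  have hcd : e₀.symm c < e₀.symm d := hcd
  have hget : ∀ v, l[(e₀.symm v : ℕ)] = v := fun v => e₀.apply_symm_apply v
  have := List.map_getElem_sublist (l := l)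
    (is := [e₀.symm a, e₀.symm b, e₀.symm c, e₀.symm d]) (by
      simp [hab, hbc, hcd, hab.trans hbc, hbc.trans hcd, (hab.trans hbc).trans hcd])
  simpa [hget] using this

/-- In a maximal outerplanar graph every missing edge is crossed by an edge, since otherwise it
could be added to the drawing on the parabola. -/
theorem IsMaximalOuterplanar.exists_crossing {n : ℕ} (h : G.IsMaximalOuterplanar) (e : V ≃ Fin n)
    (he : ∀ a b c d, e a < e b → e b < e c → e c < e d → G.Adj a c → ¬ G.Adj b d)
    {u v : V} (huv : e u < e v) (hadj : ¬ G.Adj u v) :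
    ∃ c d, G.Adj c d ∧ e u < e c ∧ e c < e v ∧ (e d < e u ∨ e v < e d) := by
  by_contra hcon
  push Not at hcon
  have hne : u ≠ v := by rintro rfl; exact lt_irrefl _ huv
  refine h.2 u v hne hadj (isOuterplanar_of_noncrossing (fun v => ((e v : ℕ) : ℝ))
    (fun a b hab => e.injective (Fin.ext (Nat.cast_injective (R := ℝ) hab))) ?_)
  intro a b c d hab hbc hcd hac hbd
  have hab : e a < e b := by exact_mod_cast hab
  have hbc : e b < e c := by exact_mod_cast hbc
  have hcd : e c < e d := by exact_mod_cast hcd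
  rw [sup_adj, edge_adj] at hac hbd
  rcases hac with hac | ⟨⟨rfl, rfl⟩ | ⟨rfl, rfl⟩, -⟩
  · rcases hbd with hbd | ⟨⟨rfl, rfl⟩ | ⟨rfl, rfl⟩, -⟩
    · exact he a b c d hab hbc hcd hac hbd
    · exact absurd hab (not_lt.2 (hcon c a hac.symm hbc hcd).1)
    · exact absurd huv (not_lt.2 (hbc.trans hcd).le)
  · rcases hbd with hbd | ⟨⟨rfl, rfl⟩ | ⟨rfl, rfl⟩, -⟩
    · exact absurd hcd (not_lt.2 (hcon b d hbd hab hbc).2)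
    · exact absurd hab (lt_irrefl _)
    · exact absurd hbc (lt_irrefl _)
  · exact absurd huv (not_lt.2 (hab.trans hbc).le)

/-- If a symmetric relation on the numbers below `n` is noncrossing, and every pair that it lacks is
crossed by a pair that it has, then it contains a triangulation of the polygon `i, i + 1, …, j` for
each of its pairs `i j`. -/
theorem exists_tree {n : ℕ} {A : ℕ → ℕ → Prop} (hsymm : ∀ i j, A i j → A j i)
    (hcross : ∀ a b c d, a < b → b < c → c < d → A a c → ¬ A b d)
    (hmax : ∀ i j, i < j → j < n → ¬ A i j →
      ∃ c d, A c d ∧ i < c ∧ c < j ∧ (d < i ∨ j < d)) :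
    ∀ k i j, j = i + k + 1 → j < n → A i j → ∃ t : BinaryTree ℕ,
      inorder t = List.range' (i + 1) k ∧ ∀ x y, polyAdj t i j x y → A x y := by
  intro k
  induction k using Nat.strong_induction_on with
  | _ k ih =>
    intro i j hij hj hA
    have hend : ∀ x y, (x = i ∧ y = j) ∨ (x = j ∧ y = i) → A x y := by
      rintro x y (⟨rfl, rfl⟩ | ⟨rfl, rfl⟩)
      exacts [hA, hsymm _ _ hA]
    rcases Nat.eq_zero_or_pos k with rfl | hk
    · exact ⟨.nil, rfl, hend⟩
    have hcons : A i (i + 1) := by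
      by_contra h
      obtain ⟨c, d, -, h1, h2, -⟩ := hmax i (i + 1) (by omega) (by omega) h
      omega
    -- the apex is the last neighbour of `i` before `j`
    classical
    obtain ⟨m, hm, him, hmj, hlast⟩ : ∃ m, A i m ∧ i + 1 ≤ m ∧ m ≤ j - 1 ∧
        ∀ d, m < d → d ≤ j - 1 → ¬ A i d :=
      ⟨Nat.findGreatest (fun m => A i m) (j - 1),
        Nat.findGreatest_spec (P := fun m => A i m) (m := i + 1) (by omega) hcons,
        Nat.le_findGreatest (by omega) hcons, Nat.findGreatest_le _,
        fun d h1 h2 => Nat.findGreatest_is_greatest h1 h2⟩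
    -- an edge that crosses `m j` would cross `i j` or `i m`, or contradict the choice of `m`
    have hmA : A m j := by
      by_contra h
      obtain ⟨c, d, hcd, h1, h2, h3⟩ := hmax m j (by omega) hj h
      rcases h3 with h3 | h3
      · rcases lt_trichotomy d i with hd | rfl | hd
        · exact hcross d i c j hd (by omega) h2 (hsymm _ _ hcd) hA
        · exact hlast c h1 (by omega) (hsymm _ _ hcd)
        · exact hcross i d m c hd h3 h1 hm (hsymm _ _ hcd)
      · exact hcross i c j d (by omega) h2 h3 hA hcd
    obtain ⟨p, rfl⟩ := Nat.exists_eq_add_of_le him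
    obtain ⟨q, rfl⟩ : ∃ q, k = p + (q + 1) := ⟨k - p - 1, by omega⟩
    obtain ⟨l, hl, hlA⟩ := ih p (by omega) i (i + 1 + p) (by omega) (by omega) hm
    obtain ⟨r, hr, hrA⟩ := ih q (by omega) (i + 1 + p) j (by omega) hj hmA
    refine ⟨.node (i + 1 + p) l r, ?_, ?_⟩
    · rw [inorder, hl, hr, ← List.range'_succ, List.range'_append_1]
    · rintro x y (h | h | h)
      exacts [hend x y h, hlA x y h, hrA x y h]

/-- A maximal outerplanar graph contains a triangulated polygon through all its vertices. It is even
equal to it, but more edges would make domination only easier. -/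
theorem IsMaximalOuterplanar.exists_polygon [Fintype V] (hG : G.IsMaximalOuterplanar)
    (hn : 3 ≤ Fintype.card V) : ∃ (e : V ≃ Fin (Fintype.card V)) (t : BinaryTree ℕ),
      inorder t = List.range' 1 (Fintype.card V - 2) ∧
      ∀ x y, polyAdj t 0 (Fintype.card V - 1) x y →
        ∃ u v, (e u : ℕ) = x ∧ (e v : ℕ) = y ∧ G.Adj u v := by
  obtain ⟨e, he⟩ := hG.1.exists_equiv_fin
  let A : ℕ → ℕ → Prop := fun x y => ∃ u v, (e u : ℕ) = x ∧ (e v : ℕ) = y ∧ G.Adj u v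
  have hmax : ∀ i j, i < j → j < Fintype.card V → ¬ A i j →
      ∃ c d, A c d ∧ i < c ∧ c < j ∧ (d < i ∨ j < d) := by
    intro i j hij hj hA
    have hi := hij.trans hj
    obtain ⟨c, d, hcd, h1, h2, h3⟩ := hG.exists_crossing e he
      (u := e.symm ⟨i, hi⟩) (v := e.symm ⟨j, hj⟩) (by simpa using hij)
      (fun h => hA ⟨_, _, by simp, by simp, h⟩)
    simp only [Equiv.apply_symm_apply, Fin.lt_def] at h1 h2 h3
    exact ⟨e c, e d, ⟨c, d, rfl, rfl, hcd⟩, h1, h2, h3⟩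
  have hends : A 0 (Fintype.card V - 1) := by
    by_contra h
    obtain ⟨c, d, ⟨u, v, rfl, rfl, -⟩, -, -, h3⟩ := hmax 0 (Fintype.card V - 1) (by omega)
      (by omega) h
    have := (e v).2
    omega
  obtain ⟨t, ht, hA⟩ := exists_tree (n := Fintype.card V) (A := A)
    (fun i j ⟨u, v, hu, hv, h⟩ => ⟨v, u, hv, hu, h.symm⟩) (by
      rintro _ _ _ _ hab hbc hcd ⟨a, c, rfl, rfl, hac⟩ ⟨b, d, rfl, rfl, hbd⟩
      exact he a b c d hab hbc hcd hac hbd) hmax (Fintype.card V - 2) 0 (Fintype.card V - 1)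
    (by omega) (by omega) hends
  exact ⟨e, t, ht, hA⟩

end SimpleGraph

/-! ### Replacing one side of a triangulated polygon -/

section Domination
variable {α : Type*}

/-- The vertices of the triangulated polygon encoded by `t`, `i` and `j` in their circular
order. -/
def polyVerts (t : BinaryTree α) (i j : α) : List α := i :: (inorder t ++ [j])

theorem polyAdj_self (t : BinaryTree α) (i j : α) : polyAdj t i j i j ∧ polyAdj t i j j i := by
  cases t <;> simp [polyAdj]

theorem polyAdj_symm {t : BinaryTree α} {i j x y : α} (h : polyAdj t i j x y) :
    polyAdj t i j y x := by
  induction t generalizing i j with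
  | nil => simp only [polyAdj] at h ⊢; tauto
  | node m l r ihl ihr =>
    rcases h with h | h | h
    · exact Or.inl (by tauto)
    · exact Or.inr (Or.inl (ihl h))
    · exact Or.inr (Or.inr (ihr h))

theorem mem_of_polyAdj {t : BinaryTree α} {i j x y : α} (h : polyAdj t i j x y) :
    x ∈ polyVerts t i j := by
  induction t generalizing i j with
  | nil => simp only [polyAdj, polyVerts, inorder] at h ⊢; aesop
  | node m l r ihl ihr =>
    simp only [polyVerts, List.mem_cons, List.mem_append, inorder, List.not_mem_nil,
      or_false] at ihl ihr ⊢
    rcases h with (h | h) | h | h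
    · exact Or.inl h.1
    · exact Or.inr (Or.inr h.1)
    · have := ihl h; tauto
    · have := ihr h; tauto

theorem not_polyAdj_self {t : BinaryTree α} {i j x : α} (hnd : (polyVerts t i j).Nodup) :
    ¬ polyAdj t i j x x := by
  induction t generalizing i j with
  | nil =>
    simp only [polyVerts, inorder, polyAdj] at hnd ⊢
    simp at hnd
    grind
  | node m l r ihl ihr =>
    simp only [polyVerts, inorder, List.nodup_cons, List.nodup_append, List.mem_append,
      List.mem_cons] at hnd ihl ihr
    rintro (h | h | h)
    · grind
    · exact ihl (by grind) h
    · exact ihr (by grind) h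

/-- Every element of `A` is adjacent to some element of `T`. -/
def TotallyDominates (r : α → α → Prop) (A T : Set α) : Prop := ∀ w ∈ A, ∃ x ∈ T, r w x

/-- `S` is a secure total dominating set of the graph with vertex set `A` and adjacency `r`. -/
structure SecurelyDominates (r : α → α → Prop) (A S : Set α) : Prop where
  subset : S ⊆ A
  total : TotallyDominates r A S
  secure : ∀ u ∈ A, u ∉ S → ∃ v ∈ S, r u v ∧ TotallyDominates r A (insert u (S \ {v}))

/-- The conditions that a set `Y` of vertices of a piece of a graph must satisfy in order to take
the place there of a secure total dominating set. Here `P` is the set of vertices of the piece and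
`r` its adjacency, `K` is the set of ends of the piece that the old set contains, and `X` is a set
of ends that the old set takes care of from outside. The vertices of `K` have to remain in the set
(`keep`). They may have to move outwards, and then must not be missed inside (`total_erase`); they
may be needed outside, and so must not move inwards (the condition `v ∉ K` in `secure`). -/
structure LocallySecure (r : α → α → Prop) (P K X Y : Set α) : Prop where
  subset : Y ⊆ P
  keep : K ⊆ Y
  total : TotallyDominates r (P \ X) Y
  total_erase : ∀ v ∈ K, TotallyDominates r (P \ X) (Y \ {v})
  secure : ∀ u ∈ P, u ∉ X → u ∉ Y → ∃ v ∈ Y, v ∉ K ∧ r u v ∧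
    TotallyDominates r (P \ X) (insert u (Y \ {v}))

/-- A graph consists of an outer part, with vertex set `O` and adjacency `r₀`, and a triangulated
polygon `s` attached to it at the vertices `i` and `j`. A secure total dominating set `S'` of the
graph with another polygon `s'` in place of `s` gives one of the graph itself: within `O` the set
`S'` is kept, and within the polygon a set `Y` with the property `LocallySecure` is added. The set
`X` consists of ends without neighbour in `S'` inside `s'`; these are dominated, and defended if
they are not in `S'`, by vertices of `O`, which remains so. -/
theorem SecurelyDominates.replace {r₀ : α → α → Prop} {O : Set α} {i j : α} {s s' : BinaryTree α}
    (hr₀ : ∀ x y, r₀ x y → x ∈ O ∧ y ∈ O) (hi : i ∈ O) (hj : j ∈ O)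
    (hs : ∀ x ∈ inorder s, x ∉ O) (hs' : ∀ x ∈ inorder s', x ∉ O)
    (hnd' : (polyVerts s' i j).Nodup) {S' Y X : Set α}
    (hS' : SecurelyDominates (fun x y => r₀ x y ∨ polyAdj s' i j x y)
      (O ∪ {x | x ∈ inorder s'}) S')
    (hX : ∀ w ∈ X, (w = i ∨ w = j) ∧ ∀ x ∈ inorder s', x ∈ S' → ¬ polyAdj s' i j w x)
    (hY : LocallySecure (polyAdj s i j) {x | x ∈ polyVerts s i j} (S' ∩ {i, j}) X Y) :
    SecurelyDominates (fun x y => r₀ x y ∨ polyAdj s i j x y) (O ∪ {x | x ∈ inorder s})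
      ((S' ∩ O) ∪ Y) := by
  have hP : ∀ x, x ∈ polyVerts s i j ↔ x = i ∨ x = j ∨ x ∈ inorder s := fun x => by
    simp only [polyVerts, List.mem_cons, List.mem_append, List.not_mem_nil]; tauto
  have hP' : ∀ x, x ∈ polyVerts s' i j ↔ x = i ∨ x = j ∨ x ∈ inorder s' := fun x => by
    simp only [polyVerts, List.mem_cons, List.mem_append, List.not_mem_nil]; tauto
  have hadj : ∀ w x, polyAdj s' i j w x → w ∈ O → x ∈ O → polyAdj s i j w x := by
    intro w x h hw hx
    have hne := not_polyAdj_self (x := i) hnd'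
    have hne' := not_polyAdj_self (x := j) hnd'
    rcases (hP' w).1 (mem_of_polyAdj h) with rfl | rfl | hw'
    · rcases (hP' x).1 (mem_of_polyAdj (polyAdj_symm h)) with rfl | rfl | hx'
      exacts [absurd h hne, (polyAdj_self _ _ _).1, absurd hx (hs' x hx')]
    · rcases (hP' x).1 (mem_of_polyAdj (polyAdj_symm h)) with rfl | rfl | hx'
      exacts [(polyAdj_self _ _ _).2, absurd h hne', absurd hx (hs' x hx')]
    · exact absurd hw (hs' w hw')
  -- a set that dominates the old graph outside, and the new side inside, dominates the new graph
  have key : ∀ T' Z T : Set α, TotallyDominates (fun x y => r₀ x y ∨ polyAdj s' i j x y)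
      (O ∪ {x | x ∈ inorder s'}) T' → (∀ x ∈ inorder s', x ∈ T' → x ∈ S') → T' ∩ O ⊆ T → Z ⊆ T →
      TotallyDominates (polyAdj s i j) ({x | x ∈ polyVerts s i j} \ X) Z →
      TotallyDominates (fun x y => r₀ x y ∨ polyAdj s i j x y) (O ∪ {x | x ∈ inorder s}) T := by
    intro T' Z T hT' hTS hTO hZT hZ w hw
    by_cases hin : w ∈ polyVerts s i j ∧ w ∉ X
    · obtain ⟨x, hx, hwx⟩ := hZ w hin
      exact ⟨x, hZT hx, Or.inr hwx⟩
    · have hwO : w ∈ O := by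
        rcases hw with hw | hw
        · exact hw
        · by_cases hwX : w ∈ X
          · rcases (hX w hwX).1 with rfl | rfl <;> assumption
          · exact absurd ⟨(hP w).2 (Or.inr (Or.inr hw)), hwX⟩ hin
      obtain ⟨x, hx, hwx⟩ := hT' w (Or.inl hwO)
      rcases hwx with hwx | hwx
      · exact ⟨x, hTO ⟨hx, (hr₀ _ _ hwx).2⟩, Or.inl hwx⟩
      · by_cases hxO : x ∈ O
        · exact ⟨x, hTO ⟨hx, hxO⟩, Or.inr (hadj _ _ hwx hwO hxO)⟩
        · exfalso
          have hwX : w ∈ X := by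
            by_contra hwX
            apply hin
            rcases (hP' w).1 (mem_of_polyAdj hwx) with rfl | rfl | hw'
            · exact ⟨(hP w).2 (Or.inl rfl), hwX⟩
            · exact ⟨(hP w).2 (Or.inr (Or.inl rfl)), hwX⟩
            · exact absurd hwO (hs' w hw')
          rcases (hP' x).1 (mem_of_polyAdj (polyAdj_symm hwx)) with rfl | rfl | hx'
          · exact hxO hi
          · exact hxO hj
          · exact (hX w hwX).2 x hx' (hTS x hx' hx) hwx
  have hYO : ∀ x ∈ Y, x ∈ O → x = i ∨ x = j := by
    intro x hx hxO
    rcases (hP x).1 (hY.subset hx) with h | h | h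
    exacts [Or.inl h, Or.inr h, absurd hxO (hs x h)]
  refine ⟨?_, ?_, ?_⟩
  · rintro x (hx | hx)
    · exact Or.inl hx.2
    · rcases (hP x).1 (hY.subset hx) with rfl | rfl | h
      exacts [Or.inl hi, Or.inl hj, Or.inr h]
  · exact key S' Y _ hS'.total (fun _ _ h => h) Set.subset_union_left Set.subset_union_right
      hY.total
  · intro u hu huS
    have huS' : u ∈ O → u ∉ S' := fun h h' => huS (Or.inl ⟨h', h⟩)
    have huY : u ∉ Y := fun h => huS (Or.inr h)
    by_cases hin : u ∈ polyVerts s i j ∧ u ∉ X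
    -- inside the polygon `Y` provides a defender, which does not belong to `S' ∩ O`
    · obtain ⟨v, hvY, hvK, huv, hdom⟩ := hY.secure u hin.1 hin.2 huY
      refine ⟨v, Or.inr hvY, Or.inr huv, key S' _ _ hS'.total (fun _ _ h => h) ?_
        (Set.insert_subset_insert (Set.sdiff_subset_sdiff_left Set.subset_union_right)) hdom⟩
      rintro x ⟨hxS, hxO⟩
      refine Or.inr ⟨Or.inl ⟨hxS, hxO⟩, ?_⟩
      rintro rfl
      exact hvK ⟨hxS, hYO x hvY hxO⟩
    · have huO : u ∈ O := by
        rcases hu with hu | hu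
        · exact hu
        · by_cases huX : u ∈ X
          · rcases (hX u huX).1 with rfl | rfl <;> assumption
          · exact absurd ⟨(hP u).2 (Or.inr (Or.inr hu)), huX⟩ hin
      -- outside the defender in `S'` is taken
      obtain ⟨v, hv, huv, hdom⟩ := hS'.secure u (Or.inl huO) (huS' huO)
      have hvO : v ∈ O := by
        rcases huv with huv | huv
        · exact (hr₀ _ _ huv).2
        · rcases (hP' v).1 (mem_of_polyAdj (polyAdj_symm huv)) with rfl | rfl | hv'
          · exact hi
          · exact hj
          · exfalso
            have huX : u ∈ X := by
              by_contra huX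
              apply hin
              rcases (hP' u).1 (mem_of_polyAdj huv) with rfl | rfl | hu'
              · exact ⟨(hP u).2 (Or.inl rfl), huX⟩
              · exact ⟨(hP u).2 (Or.inr (Or.inl rfl)), huX⟩
              · exact absurd huO (hs' u hu')
            exact (hX u huX).2 v hv' hv huv
      refine ⟨v, Or.inl ⟨hv, hvO⟩, huv.imp id fun h => hadj _ _ h huO hvO,
        key _ (Y \ {v}) _ hdom ?_ ?_ ?_ ?_⟩
      · rintro x hx (rfl | hx')
        · exact absurd huO (hs' x hx)
        · exact hx'.1
      · rintro x ⟨rfl | hx, hxO⟩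
        · exact Or.inl rfl
        · exact Or.inr ⟨Or.inl ⟨hx.1, hxO⟩, hx.2⟩
      · exact fun x hx => Or.inr ⟨Or.inr hx.1, hx.2⟩
      · -- if the defender is an end in `Y`, then `Y` dominates the polygon without it
        by_cases hvY : v ∈ Y
        · exact hY.total_erase v ⟨hv, hYO v hvY hvO⟩
        · rw [Set.sdiff_singleton_eq_self hvY]
          exact hY.total

end Domination

/-! ### Numbered polygons and the local conditions for sets encoded by bits -/

section Labelling
variable {α β : Type*}

theorem length_inorder (t : BinaryTree α) : (inorder t).length = t.numNodes := by
  induction t with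
  | nil => rfl
  | node m l r ihl ihr => simp [inorder, ihl, ihr]; omega

theorem numNodes_map (f : α → β) (t : BinaryTree α) : (t.map f).numNodes = t.numNodes := by
  induction t with
  | nil => rfl
  | node m l r ihl ihr => simp [BinaryTree.map, ihl, ihr]

theorem inorder_map (f : α → β) (t : BinaryTree α) : inorder (t.map f) = (inorder t).map f := by
  induction t with
  | nil => rfl
  | node m l r ihl ihr => simp [BinaryTree.map, inorder, ihl, ihr]

/-- The tree `t` with its nodes numbered from left to right, starting with `o`. -/
def number : BinaryTree Unit → ℕ → BinaryTree ℕ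
  | .nil, _ => .nil
  | .node _ l r, o => .node (o + l.numNodes) (number l o) (number r (o + l.numNodes + 1))

theorem numNodes_number (t : BinaryTree Unit) (o : ℕ) : (number t o).numNodes = t.numNodes := by
  induction t generalizing o with
  | nil => rfl
  | node m l r ihl ihr => simp [number, ihl, ihr]

theorem inorder_number (t : BinaryTree Unit) (o : ℕ) :
    inorder (number t o) = List.range' o t.numNodes := by
  induction t generalizing o with
  | nil => rfl
  | node m l r ihl ihr =>
    rw [number, inorder, ihl, ihr, ← List.range'_succ, List.range'_append_1, BinaryTree.numNodes]
    congr 1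

/-- The tree without its labels. -/
def shape (t : BinaryTree α) : BinaryTree Unit := t.map fun _ => ()

/-- A tree is determined by its shape and the labels from left to right. -/
theorem number_shape_map {φ : ℕ → α} (t : BinaryTree α) (o : ℕ)
    (h : ∀ n (hn : n < (inorder t).length), φ (o + n) = (inorder t)[n]) :
    (number (shape t) o).map φ = t := by
  induction t generalizing o with
  | nil => rfl
  | node m l r ihl ihr =>
    have hl : (inorder l).length = (shape l).numNodes := by
      rw [length_inorder, shape, numNodes_map]
    simp only [shape, BinaryTree.map, number] at ihl ihr ⊢
    simp only [inorder, List.length_append, List.length_cons] at h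
    rw [ihl, ihr]
    · congr 1
      have := h (inorder l).length (by omega)
      rw [List.getElem_append_right le_rfl] at this
      rw [shape] at hl
      simpa [← hl] using this
    · intro n hn
      have := h ((inorder l).length + (n + 1)) (by omega)
      rw [List.getElem_append_right (by omega)] at this
      simp only [Nat.add_sub_cancel_left, List.getElem_cons_succ] at this
      rw [shape] at hl
      rw [← this, hl]
      congr 1
      omega
    · intro n hn
      rw [h n (by omega), List.getElem_append_left hn]

theorem polyAdj_map {φ : ℕ → α} {t : BinaryTree ℕ} {i j : ℕ} {x y : α} :
    polyAdj (t.map φ) (φ i) (φ j) x y ↔ ∃ a b, polyAdj t i j a b ∧ φ a = x ∧ φ b = y := by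
  induction t generalizing i j with
  | nil =>
    simp only [BinaryTree.map, polyAdj]
    constructor
    · rintro (⟨rfl, rfl⟩ | ⟨rfl, rfl⟩)
      exacts [⟨i, j, Or.inl ⟨rfl, rfl⟩, rfl, rfl⟩, ⟨j, i, Or.inr ⟨rfl, rfl⟩, rfl, rfl⟩]
    · rintro ⟨a, b, ⟨rfl, rfl⟩ | ⟨rfl, rfl⟩, rfl, rfl⟩
      exacts [Or.inl ⟨rfl, rfl⟩, Or.inr ⟨rfl, rfl⟩]
  | node m l r ihl ihr =>
    simp only [BinaryTree.map, polyAdj, ihl, ihr]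
    constructor
    · rintro ((⟨rfl, rfl⟩ | ⟨rfl, rfl⟩) | ⟨a, b, h, rfl, rfl⟩ | ⟨a, b, h, rfl, rfl⟩)
      exacts [⟨i, j, Or.inl (Or.inl ⟨rfl, rfl⟩), rfl, rfl⟩,
        ⟨j, i, Or.inl (Or.inr ⟨rfl, rfl⟩), rfl, rfl⟩,
        ⟨a, b, Or.inr (Or.inl h), rfl, rfl⟩, ⟨a, b, Or.inr (Or.inr h), rfl, rfl⟩]
    · rintro ⟨a, b, (⟨rfl, rfl⟩ | ⟨rfl, rfl⟩) | h | h, rfl, rfl⟩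
      exacts [Or.inl (Or.inl ⟨rfl, rfl⟩), Or.inl (Or.inr ⟨rfl, rfl⟩),
        Or.inr (Or.inl ⟨a, b, h, rfl, rfl⟩), Or.inr (Or.inr ⟨a, b, h, rfl, rfl⟩)]

/-- The vertices of the polygon of shape `u`, which has `n` nodes, are numbered by `0, …, n + 1` in
their circular order, with `0` and `n + 1` for the two ends of the distinguished side. The function
`φ` maps this numbered polygon to the polygon encoded by `s`, `i` and `j`. Its values at other
numbers play no role. -/
structure IsLabelling (u : BinaryTree Unit) (φ : ℕ → α) (s : BinaryTree α) (i j : α) : Prop where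
  tree : (number u 1).map φ = s
  left : φ 0 = i
  right : φ (u.numNodes + 1) = j
  inj : Set.InjOn φ {n | n < u.numNodes + 2}

namespace IsLabelling
variable {u : BinaryTree Unit} {φ : ℕ → α} {s : BinaryTree α} {i j : α}

theorem polyVerts_eq (h : IsLabelling u φ s i j) :
    polyVerts s i j = (List.range (u.numNodes + 2)).map φ := by
  rw [polyVerts, ← h.tree, inorder_map, inorder_number, ← h.left, ← h.right,
    List.range_succ, List.range_eq_range', List.range'_succ]
  simp

theorem mem_polyVerts (h : IsLabelling u φ s i j) {x : α} :
    x ∈ polyVerts s i j ↔ ∃ n < u.numNodes + 2, φ n = x := by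
  simp [h.polyVerts_eq]

theorem mem_inorder (h : IsLabelling u φ s i j) {x : α} :
    x ∈ inorder s ↔ ∃ n, 1 ≤ n ∧ n < u.numNodes + 1 ∧ φ n = x := by
  rw [← h.tree, inorder_map, inorder_number, List.mem_map]
  simp only [List.mem_range'_1]
  constructor
  · rintro ⟨n, hn, rfl⟩; exact ⟨n, hn.1, by omega, rfl⟩
  · rintro ⟨n, hn, hn', rfl⟩; exact ⟨n, ⟨hn, by omega⟩, rfl⟩

theorem nodup (h : IsLabelling u φ s i j) : (polyVerts s i j).Nodup := by
  rw [h.polyVerts_eq]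
  exact List.Nodup.map_on (fun a ha b hb hab => h.inj (by simpa using ha) (by simpa using hb) hab)
    List.nodup_range

theorem lt_of_polyAdj {a b : ℕ} (h : polyAdj (number u 1) 0 (u.numNodes + 1) a b) :
    a < u.numNodes + 2 := by
  have := mem_of_polyAdj h
  simp only [polyVerts, inorder_number, List.mem_cons, List.mem_append, List.mem_range'_1,
    List.not_mem_nil, or_false] at this
  omega

theorem polyAdj_iff (h : IsLabelling u φ s i j) {a b : ℕ} (ha : a < u.numNodes + 2)
    (hb : b < u.numNodes + 2) :
    polyAdj s i j (φ a) (φ b) ↔ polyAdj (number u 1) 0 (u.numNodes + 1) a b := by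
  rw [← h.tree, ← h.left, ← h.right, polyAdj_map]
  constructor
  · rintro ⟨a', b', hab, ha', hb'⟩
    rwa [← h.inj (lt_of_polyAdj hab) ha ha', ← h.inj (lt_of_polyAdj (polyAdj_symm hab)) hb hb']
  · exact fun hab => ⟨a, b, hab, rfl, rfl⟩

end IsLabelling

theorem exists_isLabelling {s : BinaryTree α} {i j : α} (hnd : (polyVerts s i j).Nodup) :
    ∃ φ : ℕ → α, IsLabelling (shape s) φ s i j := by
  have hlen : (inorder s).length = (shape s).numNodes := by
    rw [length_inorder, shape, numNodes_map]
  refine ⟨fun n => (polyVerts s i j).getD n i, number_shape_map s 1 ?_, by simp [polyVerts], ?_, ?_⟩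
  · intro n hn
    have h1 : (polyVerts s i j)[1 + n]? = some (inorder s)[n] := by
      rw [Nat.add_comm, polyVerts, List.getElem?_cons_succ, List.getElem?_append_left hn,
        List.getElem?_eq_getElem hn]
    simp [List.getD, h1]
  · simp [polyVerts, ← hlen]
  · have hl : (polyVerts s i j).length = (shape s).numNodes + 2 := by
      simp [polyVerts, hlen]
    intro a ha b hb hab
    rw [← hl] at ha hb
    have ha : a < (polyVerts s i j).length := ha
    have hb : b < (polyVerts s i j).length := hb
    simp only [List.getD_eq_getElem _ _ ha, List.getD_eq_getElem _ _ hb] at hab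
    exact (hnd.getElem_inj_iff).1 hab

end Labelling

section Masks

/-- The neighbours of `w` in the polygon, as a set of numbers encoded by its bits. -/
def nbrMask : BinaryTree ℕ → ℕ → ℕ → ℕ → ℕ
  | .nil, i, j, w => (if w = i then 2 ^ j else 0) ||| (if w = j then 2 ^ i else 0)
  | .node m l r, i, j, w =>
    ((if w = i then 2 ^ j else 0) ||| (if w = j then 2 ^ i else 0)) |||
      (nbrMask l i m w ||| nbrMask r m j w)

theorem testBit_nbrMask {t : BinaryTree ℕ} {i j w x : ℕ} :
    (nbrMask t i j w).testBit x = true ↔ polyAdj t i j w x := by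
  have hbase : ∀ i j : ℕ, ((if w = i then 2 ^ j else 0) ||| (if w = j then 2 ^ i else 0)).testBit x
      = true ↔ (w = i ∧ x = j) ∨ (w = j ∧ x = i) := by
    intro i j
    rw [Nat.testBit_or, Bool.or_eq_true]
    split_ifs <;> simp [Nat.testBit_two_pow] <;> omega
  induction t generalizing i j with
  | nil => exact hbase i j
  | node m l r ihl ihr =>
    rw [nbrMask, Nat.testBit_or, Bool.or_eq_true, hbase, Nat.testBit_or, Bool.or_eq_true, polyAdj]
    exact or_congr Iff.rfl (or_congr ihl ihr)

/-- The neighbours of the vertex `w` of the numbered polygon of shape `u`. -/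
def nbrs (u : BinaryTree Unit) (w : ℕ) : ℕ := nbrMask (number u 1) 0 (u.numNodes + 1) w

theorem testBit_nbrs {u : BinaryTree Unit} {w x : ℕ} : (nbrs u w).testBit x = true ↔
    polyAdj (number u 1) 0 (u.numNodes + 1) w x := testBit_nbrMask

theorem and_ne_zero_iff {a b : ℕ} : (a &&& b != 0) = true ↔
    ∃ x, a.testBit x = true ∧ b.testBit x = true := by
  rw [bne_iff_ne]
  constructor
  · intro h
    obtain ⟨x, hx⟩ := Nat.exists_testBit_of_ne_zero h
    exact ⟨x, by simpa using hx⟩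
  · rintro ⟨x, ha, hb⟩ h
    have := congrArg (Nat.testBit · x) h
    simp [ha, hb] at this

/-- The set encoded by `Z` totally dominates the vertices of the polygon of shape `u` outside the
set encoded by `X`. -/
def dominatesMask (u : BinaryTree Unit) (X Z : ℕ) : Bool :=
  (List.range (u.numNodes + 2)).all fun w => X.testBit w || (nbrs u w &&& Z != 0)

/-- The set encoded by `Y` without `v`. -/
def eraseMask (Y v : ℕ) : ℕ := Y ^^^ (Y &&& 2 ^ v)

theorem testBit_eraseMask {Y v x : ℕ} :
    (eraseMask Y v).testBit x = true ↔ Y.testBit x = true ∧ x ≠ v := by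
  rw [eraseMask, Nat.testBit_xor, Nat.testBit_and, Nat.testBit_two_pow]
  by_cases h : v = x
  · simp [h]
  · simp [h, Ne.symm h]

theorem testBit_insertMask {Y v x : ℕ} :
    (Y ||| 2 ^ v).testBit x = true ↔ x = v ∨ Y.testBit x = true := by
  rw [Nat.testBit_or, Nat.testBit_two_pow]
  rw [Bool.or_eq_true, decide_eq_true_iff, or_comm, eq_comm]

/-- The local conditions of `LocallySecure` for sets of numbers encoded by their bits. -/
def locallySecureMask (u : BinaryTree Unit) (K X Y : ℕ) : Bool :=
  (List.range (u.numNodes + 2)).all (fun v => !K.testBit v ||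
    (Y.testBit v && dominatesMask u X (eraseMask Y v))) &&
  dominatesMask u X Y &&
  (List.range (u.numNodes + 2)).all fun w => X.testBit w || Y.testBit w ||
    (List.range (u.numNodes + 2)).any fun v => Y.testBit v && !K.testBit v &&
      (nbrs u w).testBit v && dominatesMask u X (eraseMask Y v ||| 2 ^ w)

/-- The labels of the elements of the set encoded by `M`. -/
def maskSet {α : Type*} (u : BinaryTree Unit) (φ : ℕ → α) (M : ℕ) : Set α :=
  {x | ∃ n < u.numNodes + 2, M.testBit n = true ∧ φ n = x}

variable {α : Type*} {u : BinaryTree Unit} {φ : ℕ → α} {s : BinaryTree α} {i j : α}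

theorem IsLabelling.mem_maskSet (h : IsLabelling u φ s i j) {M n : ℕ} (hn : n < u.numNodes + 2) :
    φ n ∈ maskSet u φ M ↔ M.testBit n = true :=
  ⟨fun ⟨_, hm, hM, hmn⟩ => h.inj hm hn hmn ▸ hM, fun hM => ⟨n, hn, hM, rfl⟩⟩

theorem IsLabelling.totallyDominates (h : IsLabelling u φ s i j) {X Z : ℕ} {T : Set α}
    (hd : dominatesMask u X Z = true)
    (hZT : ∀ n < u.numNodes + 2, Z.testBit n = true → φ n ∈ T) :
    TotallyDominates (polyAdj s i j) ({x | x ∈ polyVerts s i j} \ maskSet u φ X) T := by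
  rintro x ⟨hx, hxX⟩
  obtain ⟨w, hw, rfl⟩ := h.mem_polyVerts.1 hx
  rw [h.mem_maskSet hw] at hxX
  have h1 := List.all_eq_true.1 hd w (List.mem_range.2 hw)
  rw [Bool.or_eq_true] at h1
  obtain ⟨y, hy, hyZ⟩ := and_ne_zero_iff.1 (h1.resolve_left hxX)
  rw [testBit_nbrs] at hy
  have hyn := IsLabelling.lt_of_polyAdj (polyAdj_symm hy)
  exact ⟨φ y, hZT y hyn hyZ, (h.polyAdj_iff hw hyn).2 hy⟩

/-- Soundness of the computation of the local conditions. -/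
theorem IsLabelling.locallySecure (h : IsLabelling u φ s i j) {K X Y : ℕ}
    (hc : locallySecureMask u K X Y = true) :
    LocallySecure (polyAdj s i j) {x | x ∈ polyVerts s i j} (maskSet u φ K) (maskSet u φ X)
      (maskSet u φ Y) := by
  simp only [locallySecureMask, Bool.and_eq_true, List.all_eq_true, List.mem_range, Bool.or_eq_true,
    List.any_eq_true, Bool.not_eq_true'] at hc
  obtain ⟨⟨hK, hY⟩, hS⟩ := hc
  refine ⟨?_, ?_, ?_, ?_, ?_⟩
  · rintro _ ⟨n, hn, -, rfl⟩
    exact h.mem_polyVerts.2 ⟨n, hn, rfl⟩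
  · rintro _ ⟨n, hn, hnK, rfl⟩
    rcases hK n hn with h' | h'
    · rw [hnK] at h'; exact absurd h' (by simp)
    · exact ⟨n, hn, h'.1, rfl⟩
  · exact h.totallyDominates hY fun n hn hnY => ⟨n, hn, hnY, rfl⟩
  · rintro _ ⟨v, hv, hvK, rfl⟩
    rcases hK v hv with h' | h'
    · rw [hvK] at h'; exact absurd h' (by simp)
    · refine h.totallyDominates h'.2 fun n hn hnY => ?_
      rw [testBit_eraseMask] at hnY
      exact ⟨⟨n, hn, hnY.1, rfl⟩, fun hnv => hnY.2 (h.inj hn hv hnv)⟩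
  · intro x hx hxX hxY
    obtain ⟨w, hw, rfl⟩ := h.mem_polyVerts.1 hx
    rw [h.mem_maskSet hw] at hxX hxY
    rcases hS w hw with (h' | h') | ⟨v, hv, ⟨⟨hvY, hvK⟩, hwv⟩, hd⟩
    · exact absurd h' hxX
    · exact absurd h' hxY
    · refine ⟨φ v, ⟨v, hv, hvY, rfl⟩, ?_, ?_, ?_⟩
      · rw [h.mem_maskSet hv, hvK]; simp
      · exact (h.polyAdj_iff hw hv).2 (testBit_nbrs.1 hwv)
      · refine h.totallyDominates hd fun n hn hnY => ?_
        rw [testBit_insertMask, testBit_eraseMask] at hnY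
        rcases hnY with rfl | hnY
        · exact Or.inl rfl
        · exact Or.inr ⟨⟨n, hn, hnY.1, rfl⟩, fun hnv => hnY.2 (h.inj hn hv hnv)⟩

/-- The number of elements of the set encoded by `M`. -/
def cardMask (u : BinaryTree Unit) (M : ℕ) : ℕ :=
  ((List.range (u.numNodes + 2)).filter fun n => M.testBit n).length

theorem maskSet_eq (M : ℕ) : maskSet u φ M =
    φ '' (((List.range (u.numNodes + 2)).filter fun n => M.testBit n).toFinset : Set ℕ) := by
  ext x
  simp [maskSet, and_assoc]

theorem finite_maskSet (M : ℕ) : (maskSet u φ M).Finite := by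
  rw [maskSet_eq]
  exact (Finset.finite_toSet _).image _

theorem IsLabelling.ncard_maskSet (h : IsLabelling u φ s i j) (M : ℕ) :
    (maskSet u φ M).ncard = cardMask u M := by
  rw [maskSet_eq, Set.InjOn.ncard_image, Set.ncard_coe_finset, List.toFinset_card_of_nodup]
  · rfl
  · exact List.nodup_range.filter _
  · intro a ha b hb hab
    simp only [List.coe_toFinset, List.mem_filter, List.mem_range, Set.mem_ofPred_eq] at ha hb
    exact h.inj ha.1 hb.1 hab

end Masks

/-! ### The reductions -/

section Table

/-- The set encoded by `q` without the two ends of the polygon of shape `u`. -/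
def innerMask (u : BinaryTree Unit) (q : ℕ) : ℕ := eraseMask (eraseMask q 0) (u.numNodes + 1)

/-- The two ends in `q`, renumbered from the polygon of shape `u'` to that of shape `u`. -/
def endsMask (u u' : BinaryTree Unit) (q : ℕ) : ℕ :=
  (if q.testBit 0 then 2 ^ 0 else 0) |||
    (if q.testBit (u'.numNodes + 1) then 2 ^ (u.numNodes + 1) else 0)

/-- The ends of the polygon of shape `u'` without neighbour in `q` other than the opposite end,
renumbered for the polygon of shape `u`. -/
def exemptMask (u u' : BinaryTree Unit) (q : ℕ) : ℕ :=
  (if nbrs u' 0 &&& innerMask u' q != 0 then 0 else 2 ^ 0) |||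
    (if nbrs u' (u'.numNodes + 1) &&& innerMask u' q != 0 then 0 else 2 ^ (u.numNodes + 1))

/-- A necessary condition on the trace `q` of a secure total dominating set in the polygon of shape
`u`, when only its two ends may have neighbours elsewhere: any other vertex has a neighbour in `q`,
and even two of them if it does not belong to `q`, one to move to it and one to dominate it then. -/
def feasibleMask (u : BinaryTree Unit) (q : ℕ) : Bool :=
  (List.range u.numNodes).all fun p => if q.testBit (p + 1) then nbrs u (p + 1) &&& q != 0 else
    (List.range (u.numNodes + 2)).any fun v => (nbrs u (p + 1)).testBit v && q.testBit v &&
      (nbrs u (p + 1) &&& eraseMask q v != 0)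

/-- The polygon of shape `u` can be replaced by the smaller one of shape `u'`: for each feasible
trace `q` of a secure total dominating set in the smaller polygon, `rows` contains a pair `(q, Y)`
such that `Y` has the local properties that allow it to take the place of `q` in the polygon of
shape `u`. Moreover, the growth in size is at most two thirds of the number of vertices gained. -/
def reducesMask (u u' : BinaryTree Unit) (rows : List (ℕ × ℕ)) : Bool :=
  u'.numNodes < u.numNodes && (List.range (2 ^ (u'.numNodes + 2))).all fun q =>
    !feasibleMask u' q || rows.any fun p => p.1 == q &&
      locallySecureMask u (endsMask u u' q) (exemptMask u u' q) p.2 &&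
      3 * cardMask u p.2 + 2 * u'.numNodes ≤ 3 * cardMask u' q + 2 * u.numNodes

/-- A single triangle. -/
def ear : BinaryTree Unit := .node () .nil .nil

/-- Two triangles that both contain the left end. -/
def leftFan : BinaryTree Unit := .node () ear .nil

/-- Two triangles that both contain the right end. -/
def rightFan : BinaryTree Unit := .node () .nil ear

/-- A triangle with a left fan attached to its left side and a right fan to its right side. -/
def twinFan : BinaryTree Unit := .node () leftFan rightFan

/-- The shapes without a side from `reductionTable`. Each comes with a set, encoded by its bits,
that is a secure total dominating set of at most two thirds of the vertices of the polygon. For the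
empty shape, a single edge, there is none, and the entry plays no role. -/
def smallShapes : List (BinaryTree Unit × ℕ) :=
  [(.nil, 3), (ear, 3), (leftFan, 5), (rightFan, 10), (twinFan, 83)]

/-- The shapes that can be replaced. An entry `(u, u', rows, Y)` says that the polygon of shape `u`
can be replaced by that of shape `u'` in the sense of `reducesMask u u' rows`, and that `Y` encodes
a secure total dominating set of at most two thirds of the vertices of the polygon of shape `u`,
which is needed when this is the whole graph. -/
def reductionTable : List (BinaryTree Unit × BinaryTree Unit × List (ℕ × ℕ) × ℕ) := [
  (.node () .nil leftFan, .nil, [(0, 6), (1, 7), (2, 22), (3, 23)], 7),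
  (.node () .nil rightFan, .nil, [(0, 20), (1, 21), (2, 22), (3, 23)], 21),
  (.node () .nil twinFan, .nil, [(0, 166), (1, 167), (2, 182), (3, 183)], 167),
  (.node () ear ear, ear, [(3, 21), (5, 21), (6, 21), (7, 21)], 13),
  (.node () ear leftFan, ear, [(3, 23), (5, 53), (6, 45), (7, 53)], 13),
  (.node () ear rightFan, ear, [(3, 29), (5, 45), (6, 45), (7, 45)], 27),
  (.node () ear twinFan, ear, [(3, 335), (5, 373), (6, 365), (7, 373)], 333),
  (.node () leftFan .nil, .nil, [(0, 5), (1, 7), (2, 21), (3, 23)], 11),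
  (.node () leftFan ear, ear, [(3, 29), (5, 45), (6, 43), (7, 45)], 27),
  (.node () leftFan leftFan, leftFan, [(3, 29), (5, 45), (6, 43), (7, 45), (11, 93), (13, 93),
    (14, 91), (15, 93)], 43),
  (.node () leftFan twinFan, leftFan, [(3, 669), (5, 669), (6, 667), (7, 669), (11, 733), (13,
    733), (14, 731), (15, 733)], 667),
  (.node () rightFan .nil, .nil, [(0, 6), (1, 7), (2, 22), (3, 23)], 11),
  (.node () rightFan ear, ear, [(3, 27), (5, 43), (6, 43), (7, 43)], 26),
  (.node () rightFan leftFan, .nil, [(0, 26), (1, 27), (2, 90), (3, 91)], 42),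
  (.node () rightFan rightFan, rightFan, [(6, 58), (7, 55), (10, 90), (11, 91), (12, 90), (13,
    91), (14, 90), (15, 91)], 58),
  (.node () rightFan twinFan, .nil, [(0, 666), (1, 667), (2, 730), (3, 731)], 666),
  (.node () twinFan .nil, .nil, [(0, 83), (1, 55), (2, 211), (3, 183)], 87),
  (.node () twinFan ear, ear, [(3, 215), (5, 349), (6, 347), (7, 349)], 211),
  (.node () twinFan leftFan, .nil, [(0, 211), (1, 215), (2, 723), (3, 727)], 339),
  (.node () twinFan rightFan, rightFan, [(6, 467), (7, 439), (10, 723), (11, 727), (12, 723),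
    (13, 727), (14, 723), (15, 727)], 467),
  (.node () twinFan twinFan, .nil, [(0, 5331), (1, 5335), (2, 5843), (3, 5847)], 5331)]

theorem reducesMask_of_mem : ∀ e ∈ reductionTable, reducesMask e.1 e.2.1 e.2.2.1 = true := by
  decide +kernel

theorem locallySecureMask_of_mem : ∀ e ∈ reductionTable,
    locallySecureMask e.1 0 0 e.2.2.2 = true ∧
      3 * cardMask e.1 e.2.2.2 ≤ 2 * (e.1.numNodes + 2) := by
  decide +kernel

theorem locallySecureMask_of_mem_small : ∀ e ∈ smallShapes, e.1 ≠ .nil →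
    locallySecureMask e.1 0 0 e.2 = true ∧ 3 * cardMask e.1 e.2 ≤ 2 * (e.1.numNodes + 2) := by
  decide +kernel

/-- A shape whose two subtrees are small is small or in the table. Hence an innermost side that is
not small is in the table. -/
theorem node_mem : ∀ l ∈ smallShapes.map Prod.fst, ∀ r ∈ smallShapes.map Prod.fst,
    .node () l r ∈ smallShapes.map Prod.fst ∨ .node () l r ∈ reductionTable.map Prod.fst := by
  decide +kernel

end Table

/-! ### The induction -/

section Induction
variable {α : Type*}

theorem testBit_innerMask {u : BinaryTree Unit} {q n : ℕ} : (innerMask u q).testBit n = true ↔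
    q.testBit n = true ∧ n ≠ 0 ∧ n ≠ u.numNodes + 1 := by
  rw [innerMask, testBit_eraseMask, testBit_eraseMask, and_assoc]

theorem testBit_ends {P Q : Prop} [Decidable P] [Decidable Q] {a b n : ℕ} :
    ((if P then 2 ^ a else 0) ||| (if Q then 2 ^ b else 0)).testBit n = true ↔
      (P ∧ n = a) ∨ (Q ∧ n = b) := by
  rw [Nat.testBit_or, Bool.or_eq_true]
  split_ifs <;> simp [Nat.testBit_two_pow, *] <;> omega

/-- Every set of numbers below `n` is encoded by the bits of a number below `2 ^ n`. -/
theorem exists_mask (n : ℕ) (P : ℕ → Prop) :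
    ∃ q < 2 ^ n, ∀ m < n, q.testBit m = true ↔ P m := by
  classical
  refine ⟨Nat.ofBits fun m : Fin n => decide (P m), Nat.ofBits_lt_two_pow _, fun m hm => ?_⟩
  rw [Nat.testBit_ofBits_lt _ _ hm]
  simp

/-- The trace of a secure total dominating set on a polygon whose vertices other than the ends have
all their neighbours within it satisfies the condition `feasibleMask`. -/
theorem IsLabelling.feasibleMask {u : BinaryTree Unit} {φ : ℕ → α} {s : BinaryTree α} {i j : α}
    (h : IsLabelling u φ s i j) {r : α → α → Prop} {A S : Set α} (hS : SecurelyDominates r A S)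
    (hA : ∀ x ∈ inorder s, x ∈ A) (hr : ∀ x ∈ inorder s, ∀ y, r x y → polyAdj s i j x y)
    {q : ℕ} (hq : ∀ n < u.numNodes + 2, q.testBit n = true ↔ φ n ∈ S) :
    feasibleMask u q = true := by
  rw [_root_.feasibleMask, List.all_eq_true]
  intro p hp
  have hp : p < u.numNodes := List.mem_range.1 hp
  have hpn : p + 1 < u.numNodes + 2 := by omega
  have hin : φ (p + 1) ∈ inorder s := h.mem_inorder.2 ⟨p + 1, by omega, by omega, rfl⟩
  have hnbr : ∀ x ∈ S, r (φ (p + 1)) x → ∃ n < u.numNodes + 2, φ n = x ∧ q.testBit n = true ∧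
      (nbrs u (p + 1)).testBit n = true := by
    intro x hx hpx
    have hadj := hr _ hin x hpx
    obtain ⟨n, hn, rfl⟩ := h.mem_polyVerts.1 (mem_of_polyAdj (polyAdj_symm hadj))
    exact ⟨n, hn, rfl, (hq n hn).2 hx, testBit_nbrs.2 ((h.polyAdj_iff hpn hn).1 hadj)⟩
  split_ifs with hb
  · obtain ⟨x, hx, hpx⟩ := hS.total _ (hA _ hin)
    obtain ⟨n, -, -, h1, h2⟩ := hnbr x hx hpx
    exact and_ne_zero_iff.2 ⟨n, h2, h1⟩
  · rw [hq _ hpn] at hb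
    obtain ⟨v, hv, huv, hdom⟩ := hS.secure _ (hA _ hin) hb
    obtain ⟨x, hx, hux⟩ := hdom _ (hA _ hin)
    obtain ⟨n, hn, rfl, h1, h2⟩ := hnbr v hv huv
    rcases hx with rfl | hx
    · exact absurd (hr _ hin _ hux) (not_polyAdj_self h.nodup)
    · obtain ⟨m, hm, rfl, h3, h4⟩ := hnbr x hx.1 hux
      rw [List.any_eq_true]
      refine ⟨n, List.mem_range.2 hn, ?_⟩
      rw [Bool.and_eq_true, Bool.and_eq_true, and_ne_zero_iff]
      refine ⟨⟨h2, h1⟩, m, h4, testBit_eraseMask.2 ⟨h3, ?_⟩⟩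
      rintro rfl
      exact hx.2 rfl

/-- A reduction applied to a polygon `s` attached to the rest of the graph at `i` and `j`. The
vertices of the smaller polygon `s'` are taken from those of `s`. -/
theorem exists_replacement {u u' : BinaryTree Unit} {rows : List (ℕ × ℕ)}
    (hc : reducesMask u u' rows = true) {φ : ℕ → α} {s : BinaryTree α} {i j : α}
    (h : IsLabelling u φ s i j) {O : Set α} {r₀ : α → α → Prop}
    (hr₀ : ∀ x y, r₀ x y → x ∈ O ∧ y ∈ O) (hi : i ∈ O) (hj : j ∈ O)
    (hs : ∀ x ∈ inorder s, x ∉ O) :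
    ∃ s' : BinaryTree α, s'.numNodes = u'.numNodes ∧ (polyVerts s' i j).Nodup ∧
      (∀ x ∈ inorder s', x ∈ inorder s) ∧ ∀ S' : Set α, S'.Finite →
      SecurelyDominates (fun x y => r₀ x y ∨ polyAdj s' i j x y) (O ∪ {x | x ∈ inorder s'}) S' →
      ∃ S : Set α, S.Finite ∧
        SecurelyDominates (fun x y => r₀ x y ∨ polyAdj s i j x y) (O ∪ {x | x ∈ inorder s}) S ∧
        3 * S.ncard + 2 * u'.numNodes ≤ 3 * S'.ncard + 2 * u.numNodes := by
  simp only [reducesMask, Bool.and_eq_true, decide_eq_true_iff, List.all_eq_true, List.mem_range,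
    Bool.or_eq_true, List.any_eq_true, Bool.not_eq_true', beq_iff_eq] at hc
  obtain ⟨hlt, hc⟩ := hc
  -- the first vertices of `s` are kept, and the right end
  let φ' : ℕ → α := fun n => if n ≤ u'.numNodes then φ n else j
  have hφ' : ∀ n, n ≤ u'.numNodes → φ' n = φ n := fun n hn => if_pos hn
  have hφj : φ' (u'.numNodes + 1) = φ (u.numNodes + 1) := by
    rw [h.right]; exact if_neg (by omega)
  have h' : IsLabelling u' φ' ((number u' 1).map φ') i j := by
    refine ⟨rfl, ?_, ?_, ?_⟩
    · rw [hφ' 0 (by omega), h.left]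
    · rw [hφj, h.right]
    · intro a ha b hb hab
      have ha : a < u'.numNodes + 2 := ha
      have hb : b < u'.numNodes + 2 := hb
      have hcase : ∀ n < u'.numNodes + 2, n ≤ u'.numNodes ∨ n = u'.numNodes + 1 := by omega
      rcases hcase a ha with ha' | rfl <;> rcases hcase b hb with hb' | rfl
      · rw [hφ' a ha', hφ' b hb'] at hab
        exact h.inj (show a < _ by omega) (show b < _ by omega) hab
      · rw [hφ' a ha', hφj] at hab
        have := h.inj (show a < _ by omega) (show u.numNodes + 1 < u.numNodes + 2 by omega) hab
        omega
      · rw [hφ' b hb', hφj] at hab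
        have := h.inj (show u.numNodes + 1 < u.numNodes + 2 by omega) (show b < _ by omega) hab
        omega
      · rfl
  generalize (number u' 1).map φ' = s' at h'
  have hsub : ∀ x ∈ inorder s', x ∈ inorder s := by
    intro x hx
    obtain ⟨n, h1, h2, rfl⟩ := h'.mem_inorder.1 hx
    exact h.mem_inorder.2 ⟨n, h1, by omega, (hφ' n (by omega)).symm⟩
  refine ⟨s', ?_, h'.nodup, hsub, ?_⟩
  · rw [← h'.tree, numNodes_map, numNodes_number]
  intro S' hfin hS'
  have hs' : ∀ x ∈ inorder s', x ∉ O := fun x hx => hs x (hsub x hx)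
  -- the trace of `S'` on the smaller polygon selects the row of the reduction
  obtain ⟨q, hq2, hq⟩ := exists_mask (u'.numNodes + 2) fun n => φ' n ∈ S'
  have hfeas : feasibleMask u' q = true := h'.feasibleMask hS' (fun x hx => Or.inr hx)
    (fun x hx y hxy => hxy.resolve_left fun h0 => hs' x hx (hr₀ _ _ h0).1) hq
  rcases hc q hq2 with hc | hc
  · rw [hfeas] at hc; exact absurd hc (by simp)
  obtain ⟨p, -, ⟨-, hsec⟩, hcard⟩ := hc
  have hloc := h.locallySecure hsec
  have hK : maskSet u φ (endsMask u u' q) = S' ∩ {i, j} := by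
    ext x
    constructor
    · rintro ⟨n, hn, hb, rfl⟩
      rw [endsMask, testBit_ends] at hb
      rcases hb with ⟨hb, rfl⟩ | ⟨hb, rfl⟩
      · rw [hq 0 (by omega), hφ' 0 (by omega)] at hb
        exact ⟨hb, Or.inl h.left⟩
      · rw [hq _ (by omega), hφj] at hb
        exact ⟨hb, Or.inr h.right⟩
    · rintro ⟨hx, rfl | rfl⟩
      · refine ⟨0, by omega, testBit_ends.2 (Or.inl ⟨?_, rfl⟩), h.left⟩
        rwa [hq 0 (by omega), h'.left]
      · refine ⟨u.numNodes + 1, by omega, testBit_ends.2 (Or.inr ⟨?_, rfl⟩), h.right⟩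
        rwa [hq _ (by omega), h'.right]
  have hX : ∀ w ∈ maskSet u φ (exemptMask u u' q), (w = i ∨ w = j) ∧
      ∀ x ∈ inorder s', x ∈ S' → ¬ polyAdj s' i j w x := by
    have hex : ∀ e < u'.numNodes + 2, ¬ (nbrs u' e &&& innerMask u' q != 0) = true →
        ∀ x ∈ inorder s', x ∈ S' → ¬ polyAdj s' i j (φ' e) x := by
      intro e he hne x hx hxS hadj
      obtain ⟨n, h1, h2, rfl⟩ := h'.mem_inorder.1 hx
      exact hne (and_ne_zero_iff.2 ⟨n, testBit_nbrs.2 ((h'.polyAdj_iff he (by omega)).1 hadj),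
        testBit_innerMask.2 ⟨(hq n (by omega)).2 hxS, by omega, by omega⟩⟩)
    rintro _ ⟨n, hn, hb, rfl⟩
    rw [exemptMask, ← ite_not, ← ite_not (p := _ = true), testBit_ends] at hb
    rcases hb with ⟨hb, rfl⟩ | ⟨hb, rfl⟩
    · refine ⟨Or.inl h.left, ?_⟩
      have h0 := hex 0 (by omega) hb
      rw [h'.left] at h0
      rw [h.left]
      exact h0
    · refine ⟨Or.inr h.right, ?_⟩
      have h0 := hex _ (by omega) hb
      rw [h'.right] at h0
      rw [h.right]
      exact h0
  rw [hK] at hloc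
  refine ⟨_, ?_, SecurelyDominates.replace hr₀ hi hj hs hs' h'.nodup hS' hX hloc, ?_⟩
  · exact (hfin.subset Set.inter_subset_left).union (finite_maskSet _)
  · -- the part `q` of `S'` is exchanged for `p.2`, which contains the elements of `q` in `O`
    have hQ : maskSet u' φ' q ⊆ S' := by
      rintro _ ⟨n, hn, hb, rfl⟩
      exact (hq n hn).1 hb
    have hcov : S' ∩ O ∪ maskSet u φ p.2 ⊆ (S' \ maskSet u' φ' q) ∪ maskSet u φ p.2 := by
      rintro x (⟨hxS, hxO⟩ | hx)
      · by_cases hxQ : x ∈ maskSet u' φ' q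
        · obtain ⟨n, hn, -, rfl⟩ := hxQ
          right
          apply hloc.keep
          refine ⟨hxS, ?_⟩
          by_contra hne
          have hne : ¬ (φ' n = i ∨ φ' n = j) := hne
          refine hs' (φ' n) (h'.mem_inorder.2 ⟨n, ?_, ?_, rfl⟩) hxO
          · rcases Nat.eq_zero_or_pos n with rfl | h0
            · exact absurd (Or.inl h'.left) hne
            · exact h0
          · rcases Nat.lt_or_ge n (u'.numNodes + 1) with h0 | h0
            · exact h0
            · obtain rfl : n = u'.numNodes + 1 := by omega
              exact absurd (Or.inr h'.right) hne
        · exact Or.inl ⟨hxS, hxQ⟩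
      · exact Or.inr hx
    have h1 := Set.ncard_le_ncard hcov ((hfin.subset Set.sdiff_subset).union (finite_maskSet _))
    have h2 := Set.ncard_union_le (S' \ maskSet u' φ' q) (maskSet u φ p.2)
    have h3 := Set.ncard_sdiff_add_ncard_of_subset hQ hfin
    rw [h.ncard_maskSet] at h2
    rw [h'.ncard_maskSet] at h3
    omega

/-- Without exempt and without prescribed vertices, the local conditions are those of a secure total
dominating set of the polygon itself. -/
theorem exists_direct {u : BinaryTree Unit} {Y : ℕ} (hc : locallySecureMask u 0 0 Y = true)
    {φ : ℕ → α} {s : BinaryTree α} {i j : α} (h : IsLabelling u φ s i j) :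
    SecurelyDominates (polyAdj s i j) {x | x ∈ polyVerts s i j} (maskSet u φ Y) := by
  have hl := h.locallySecure hc
  have h0 : maskSet u φ 0 = ∅ := by ext; simp [maskSet]
  rw [h0] at hl
  refine ⟨hl.subset, ?_, fun w hw hwY => ?_⟩
  · simpa using hl.total
  · obtain ⟨v, hv, -, hwv, hd⟩ := hl.secure w hw (by simp) hwY
    exact ⟨v, hv, hwv, by simpa using hd⟩

/-- The triangulated polygon encoded by `t`, `i` and `j` consists of the polygon encoded by `s`, `a`
and `b` and of an outer part with vertices `O` and adjacency `r₀`, to which `a` and `b` belong. -/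
structure IsSide (O : List α) (r₀ : α → α → Prop) (a b : α) (s t : BinaryTree α) (i j : α) :
    Prop where
  perm : (polyVerts t i j).Perm (O ++ inorder s)
  adj : ∀ x y, polyAdj t i j x y ↔ r₀ x y ∨ polyAdj s a b x y

/-- A triangulated polygon is small or has a side with a shape from the table. In the second case
the outer part can also be combined with any other side `s'` on the same chord `a b`. -/
theorem exists_isSide (t : BinaryTree α) : ∀ i j : α,
    shape t ∈ smallShapes.map Prod.fst ∨ ∃ (O : List α) (r₀ : α → α → Prop) (a b : α)
      (s : BinaryTree α), shape s ∈ reductionTable.map Prod.fst ∧ a ∈ O ∧ b ∈ O ∧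
      (∀ x y, r₀ x y → x ∈ O ∧ y ∈ O) ∧ IsSide O r₀ a b s t i j ∧
      ∀ s', ∃ t', IsSide O r₀ a b s' t' i j := by
  induction t with
  | nil => exact fun i j => Or.inl (by simp [shape, BinaryTree.map, smallShapes])
  | node m l r ihl ihr =>
    intro i j
    -- a side from the table in one of the subtrees, or the whole tree is small or in the table
    rcases ihl i m with hl | ⟨O, r₀, a, b, s, hs, ha, hb, hr₀, hside, hrep⟩
    swap
    · right
      have key : ∀ s' l', IsSide O r₀ a b s' l' i m → IsSide (O ++ (inorder r ++ [j]))
          (fun x y => ((x = i ∧ y = j) ∨ (x = j ∧ y = i)) ∨ r₀ x y ∨ polyAdj r m j x y)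
          a b s' (.node m l' r) i j := by
        intro s' l' h
        constructor
        · have h1 : (polyVerts (.node m l' r) i j) = polyVerts l' i m ++ (inorder r ++ [j]) := by
            simp [polyVerts, inorder]
          rw [h1, List.append_assoc]
          refine (h.perm.append_right _).trans ?_
          rw [List.append_assoc]
          exact List.perm_append_comm.append_left O
        · intro x y
          rw [polyAdj, h.adj]
          tauto
      have hmem : ∀ x, x ∈ polyVerts l i m → x ∈ O ∨ x ∈ inorder s := fun x hx => by
        simpa using hside.perm.mem_iff.1 hx
      have hend : ∀ x y, polyAdj (.nil : BinaryTree α) i m x y → x ∈ O := by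
        obtain ⟨t', ht'⟩ := hrep .nil
        intro x y h
        have hx : x ∈ polyVerts t' i m := by
          simp only [polyAdj] at h
          rcases h with ⟨rfl, -⟩ | ⟨rfl, -⟩ <;> simp [polyVerts]
        simpa [inorder] using ht'.perm.mem_iff.1 hx
      have hiO : i ∈ O := hend i m (by simp [polyAdj])
      have hmO : m ∈ O := hend m i (by simp [polyAdj])
      refine ⟨_, _, a, b, s, hs, by simp [ha], by simp [hb], ?_, key s l hside, fun s' => ?_⟩
      · have hmr : ∀ x y, polyAdj r m j x y → x ∈ O ++ (inorder r ++ [j]) := by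
          intro x y h
          have := mem_of_polyAdj h
          simp only [polyVerts, List.mem_cons] at this
          rcases this with rfl | h
          · simp [hmO]
          · simp only [List.mem_append] at h ⊢; tauto
        rintro x y ((⟨rfl, rfl⟩ | ⟨rfl, rfl⟩) | h | h)
        · simp [hiO]
        · simp [hiO]
        · simp [hr₀ x y h]
        · exact ⟨hmr x y h, hmr y x (polyAdj_symm h)⟩
      · obtain ⟨l', hl'⟩ := hrep s'
        exact ⟨_, key s' l' hl'⟩
    rcases ihr m j with hr | ⟨O, r₀, a, b, s, hs, ha, hb, hr₀, hside, hrep⟩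
    swap
    · right
      have key : ∀ s' r', IsSide O r₀ a b s' r' m j → IsSide (i :: inorder l ++ O)
          (fun x y => ((x = i ∧ y = j) ∨ (x = j ∧ y = i)) ∨ polyAdj l i m x y ∨ r₀ x y)
          a b s' (.node m l r') i j := by
        intro s' r' h
        constructor
        · have h1 : (polyVerts (.node m l r') i j) = i :: inorder l ++ polyVerts r' m j := by
            simp [polyVerts, inorder]
          rw [h1, List.append_assoc]
          exact h.perm.append_left _
        · intro x y
          rw [polyAdj, h.adj]
          tauto
      have hend : ∀ x, x = m ∨ x = j → x ∈ O := by
        obtain ⟨t', ht'⟩ := hrep .nil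
        intro x h
        have hx : x ∈ polyVerts t' m j := by
          rcases h with rfl | rfl <;> simp [polyVerts]
        simpa [inorder] using ht'.perm.mem_iff.1 hx
      have hmO : m ∈ O := hend m (Or.inl rfl)
      have hjO : j ∈ O := hend j (Or.inr rfl)
      refine ⟨_, _, a, b, s, hs, by simp [ha], by simp [hb], ?_, key s r hside, fun s' => ?_⟩
      · have hml : ∀ x y, polyAdj l i m x y → x ∈ i :: inorder l ++ O := by
          intro x y h
          have := mem_of_polyAdj h
          simp only [polyVerts, List.mem_cons, List.mem_append, List.not_mem_nil, or_false] at this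
          rcases this with rfl | h | rfl
          · simp
          · simp [h]
          · simp [hmO]
        rintro x y ((⟨rfl, rfl⟩ | ⟨rfl, rfl⟩) | h | h)
        · simp [hjO]
        · simp [hjO]
        · exact ⟨hml x y h, hml y x (polyAdj_symm h)⟩
        · simp [hr₀ x y h]
      · obtain ⟨r', hr'⟩ := hrep s'
        exact ⟨_, key s' r' hr'⟩
    rcases node_mem _ hl _ hr with h | h
    · exact Or.inl h
    · refine Or.inr ⟨[i, j], fun _ _ => False, i, j, .node m l r, h, by simp, by simp,
        fun _ _ h => h.elim, ?_, fun s' => ⟨s', ?_⟩⟩ <;>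
      exact ⟨by simp [polyVerts], by simp⟩

theorem SecurelyDominates.mono {r r' : α → α → Prop} {A A' S : Set α}
    (h : SecurelyDominates r A S) (hr : ∀ x y, r x y → r' x y) (hA : A = A') :
    SecurelyDominates r' A' S := by
  subst hA
  have hd : ∀ T, TotallyDominates r A T → TotallyDominates r' A T := fun T hT w hw => by
    obtain ⟨x, hx, hwx⟩ := hT w hw
    exact ⟨x, hx, hr _ _ hwx⟩
  refine ⟨h.subset, hd _ h.total, fun u hu huS => ?_⟩
  obtain ⟨v, hv, huv, hT⟩ := h.secure u hu huS
  exact ⟨v, hv, hr _ _ huv, hd _ hT⟩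

/-- A triangulated polygon with `n + 2 ≥ 3` vertices has a secure total dominating set of at most
two thirds of its vertices, by induction with the reductions from the table. -/
theorem exists_securelyDominates (n : ℕ) : ∀ (t : BinaryTree α) (i j : α), t.numNodes = n →
    1 ≤ n → (polyVerts t i j).Nodup → ∃ S : Set α, S.Finite ∧
      SecurelyDominates (polyAdj t i j) {x | x ∈ polyVerts t i j} S ∧
      3 * S.ncard ≤ 2 * (n + 2) := by
  induction n using Nat.strong_induction_on with
  | _ n ih =>
    intro t i j ht hn hnd
    have hshape : ∀ s : BinaryTree α, (shape s).numNodes = s.numNodes := fun s => numNodes_map _ s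
    rcases exists_isSide t i j with hsmall | ⟨O, r₀, a, b, s, hs, ha, hb, hr₀, hside, hrep⟩
    · obtain ⟨⟨u, Y⟩, he, hu⟩ := List.mem_map.1 hsmall
      have hu : u = shape t := hu
      subst hu
      obtain ⟨φ, hφ⟩ := exists_isLabelling hnd
      have hne : shape t ≠ .nil := by
        intro h
        have := hshape t
        rw [h, ht] at this
        simp at this
        omega
      obtain ⟨hc, hcard⟩ := locallySecureMask_of_mem_small _ he hne
      refine ⟨_, finite_maskSet _, exists_direct hc hφ, ?_⟩
      rw [hφ.ncard_maskSet, ← ht, ← hshape t]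
      exact hcard
    obtain ⟨⟨u, u', rows, Y⟩, he, hu⟩ := List.mem_map.1 hs
    have hu : u = shape s := hu
    subst hu
    have hndO := hside.perm.nodup_iff.1 hnd
    obtain ⟨hO, hsn, hdis⟩ := List.nodup_append.1 hndO
    have hab : a ≠ b := by
      rintro rfl
      exact not_polyAdj_self hnd ((hside.adj a a).2 (Or.inr (polyAdj_self s a a).1))
    have hsO : ∀ x ∈ inorder s, x ∉ O := fun x hx hxO => hdis x hxO x hx rfl
    have hnds : (polyVerts s a b).Nodup := by
      simp only [polyVerts, List.nodup_cons, List.nodup_append, List.mem_append, List.mem_cons,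
        List.not_mem_nil]
      refine ⟨?_, hsn, by simp, ?_⟩
      · rintro (h | h | h)
        exacts [hsO a h ha, hab h, h]
      · rintro x hx y (rfl | h) rfl
        exacts [hsO _ hx hb, h]
    obtain ⟨φ, hφ⟩ := exists_isLabelling hnds
    have hlen : n + 2 = O.length + s.numNodes := by
      have := hside.perm.length_eq
      simp only [polyVerts, List.length_cons, List.length_append, length_inorder, ht,
        List.length_nil] at this
      omega
    have hset : ∀ {s' t'}, IsSide O r₀ a b s' t' i j →
        {x | x ∈ O} ∪ {x | x ∈ inorder s'} = {x | x ∈ polyVerts t' i j} := fun {s' t'} h => by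
      ext x
      simpa using h.perm.mem_iff.symm
    have hO2 : 2 ≤ O.length := by
      by_contra hlt
      push Not at hlt
      rcases O with _ | ⟨x, _ | ⟨y, O⟩⟩
      · simp at ha
      · simp only [List.mem_singleton] at ha hb
        exact hab (ha.trans hb.symm)
      · simp at hlt
    rcases hO2.eq_or_lt with hO2 | hO3
    · -- the side is the whole polygon
      obtain ⟨x, y, rfl⟩ := List.length_eq_two.1 hO2.symm
      obtain ⟨hc, hcard⟩ := locallySecureMask_of_mem _ he
      refine ⟨_, finite_maskSet _, (exists_direct hc hφ).mono
        (fun x y h => (hside.adj x y).2 (Or.inr h)) ?_, ?_⟩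
      · rw [← hset hside]
        ext z
        simp only [polyVerts, List.mem_cons, List.mem_append, List.not_mem_nil, or_false,
          Set.mem_union, Set.mem_ofPred_eq] at ha hb ⊢
        grind
      · rw [hφ.ncard_maskSet]
        have := hshape s
        have hcard : 3 * cardMask (shape s) Y ≤ 2 * ((shape s).numNodes + 2) := hcard
        change 3 * cardMask (shape s) Y ≤ _
        simp only [List.length_cons, List.length_nil] at hlen
        omega
    · -- a third vertex in `O` ensures that the smaller polygon is not a single edge
      obtain ⟨s', hs', hnds', hsub, hS⟩ := exists_replacement (reducesMask_of_mem _ he) hφ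
        (O := {x | x ∈ O}) hr₀ ha hb hsO
      have hs' : s'.numNodes = u'.numNodes := hs'
      obtain ⟨t', hside'⟩ := hrep s'
      have hlt : u'.numNodes < (shape s).numNodes := by
        have := reducesMask_of_mem _ he
        rw [reducesMask, Bool.and_eq_true] at this
        exact of_decide_eq_true this.1
      rw [hshape] at hlt hS
      have hlen' : t'.numNodes + 2 = O.length + s'.numNodes := by
        have := hside'.perm.length_eq
        simp only [polyVerts, List.length_cons, List.length_append, length_inorder,
          List.length_nil] at this
        omega
      have hnd' : (polyVerts t' i j).Nodup := by
        rw [hside'.perm.nodup_iff, List.nodup_append]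
        refine ⟨hO, ?_, fun x hx y hy hxy => hsO y (hsub y hy) (hxy ▸ hx)⟩
        simp only [polyVerts, List.nodup_cons, List.nodup_append] at hnds'
        exact hnds'.2.1
      obtain ⟨S', hfin', hS', hcard'⟩ := ih t'.numNodes (by omega) t' i j rfl (by omega) hnd'
      obtain ⟨S, hfin, hSd, hcard⟩ := hS S' hfin' (hS'.mono (fun x y h => (hside'.adj x y).1 h)
        (hset hside').symm)
      have hcard : 3 * S.ncard + 2 * u'.numNodes ≤ 3 * S'.ncard + 2 * s.numNodes := hcard
      refine ⟨S, hfin, hSd.mono (fun x y h => (hside.adj x y).2 h) (hset hside), ?_⟩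
      omega

end Induction

theorem mainTheorem1 {V : Type*} [Fintype V] (G : SimpleGraph V)
    (hn : 3 ≤ Fintype.card V) (hG : G.IsMaximalOuterplanar) :
    G.secureTotalDominationNumber ≤ ((2 * Fintype.card V / 3 : ℕ) : ℕ∞) := by
  obtain ⟨e, t, ht, hadj⟩ := hG.exists_polygon hn
  have hnum : t.numNodes = Fintype.card V - 2 := by
    rw [← length_inorder, ht, List.length_range']
  have hverts : polyVerts t 0 (Fintype.card V - 1) = List.range (Fintype.card V) := by
    obtain ⟨k, hk⟩ : ∃ k, Fintype.card V = k + 2 := ⟨Fintype.card V - 2, by omega⟩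
    rw [polyVerts, ht, hk, List.range_succ, List.range_eq_range', List.range'_succ]
    simp
  obtain ⟨S, hfin, hS, hcard⟩ := exists_securelyDominates (Fintype.card V - 2) t 0
    (Fintype.card V - 1) hnum (by omega) (by rw [hverts]; exact List.nodup_range)
  rw [hverts] at hS
  let T : Set V := {v | (e v : ℕ) ∈ S}
  have hlift : ∀ (v : V) (x : ℕ), polyAdj t 0 (Fintype.card V - 1) (e v) x →
      ∃ w, (e w : ℕ) = x ∧ G.Adj v w := by
    intro v x h
    obtain ⟨v', w, hv', hw, h'⟩ := hadj _ _ h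
    obtain rfl : v' = v := e.injective (Fin.ext hv')
    exact ⟨w, hw, h'⟩
  have hT : G.IsSecureTotalDominatingSet T := by
    refine ⟨fun v => ?_, fun u hu => ?_⟩
    · obtain ⟨x, hx, hvx⟩ := hS.total (e v) (List.mem_range.2 (e v).2)
      obtain ⟨w, rfl, hvw⟩ := hlift v x hvx
      exact ⟨w, hx, hvw⟩
    · obtain ⟨x, hx, hux, hd⟩ := hS.secure (e u) (List.mem_range.2 (e u).2) hu
      obtain ⟨w, rfl, huw⟩ := hlift u x hux
      refine ⟨w, hx, huw, fun v => ?_⟩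
      obtain ⟨y, hy, hvy⟩ := hd (e v) (List.mem_range.2 (e v).2)
      obtain ⟨z, rfl, hvz⟩ := hlift v y hvy
      refine ⟨z, ?_, hvz⟩
      rcases hy with hy | hy
      · exact Or.inr (e.injective (Fin.ext hy))
      · exact Or.inl ⟨hy.1, fun hzw => hy.2 (by rw [Set.mem_singleton_iff.1 hzw]; rfl)⟩
  have hTcard : T.ncard ≤ S.ncard := by
    refine Set.ncard_le_ncard_of_injOn (fun v => (e v : ℕ)) (fun v hv => hv) ?_ hfin
    exact fun a _ b _ hab => e.injective (Fin.ext hab)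
  refine (iInf₂_le T hT).trans ?_
  rw [← (Set.toFinite T).cast_ncard_eq]
  exact_mod_cast (by omega : T.ncard ≤ 2 * Fintype.card V / 3)
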